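/- Let $0<p<1$, $q=1-p$, $N\in\mathbb{Z}_{\ge 0}$ and $x\in\mathbb{Z}$. A configuration $\mathcal{T}$ is a family of integers $\tau^n_i\ge x$ $(1\le i\le n\le N)$ with $\tau^n_n<\tau^n_{n-1}<\dots<\tau^n_1$ for every $n$; it is identified with the set of points $\{(n,\tau^n_i):1\le i\le n\le N\}\subset\{1,\dots,N\}\times\mathbb{Z}_{\ge x}$. Put $\phi_n(z,y)=p$ if $y\ge z$ and $\phi_n(z,y)=0$ if $y<z$, with the convention $\phi_n(\tau^n_{n+1},y)=p$ for the fictitious variables $\tau^n_{n+1}$. For $t\in\mathbb{Z}$ and $0\le k\le N-1$ put $$\widetilde F_n(y,t)=\frac{1}{2\pi i}\oint_{\Gamma_0}\frac{dw}{w}\Big(q+\frac pw\Big)^t(1-w)^{-n}w^{y},\qquad \Psi^N_k(t)=(-1)^k\widetilde F_{-k}(x+N-k-1,t),$$ where $\Gamma_0$ is a small circle around $0$, with $1$ and $-p/q$ outside, and let $$W(\mathcal{T})=\prod_{n=0}^{N-1}\det\big[\phi_n(\tau^n_i,\tau^{n+1}_j)\big]_{i,j=1}^{n+1}\;\det\big[\Psi^N_i(\tau^N_{N-j})\big]_{i,j=0}^{N-1}.$$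 Then $\sum_{\mathcal T}W(\mathcal T)$ converges absolutely to some $Z_N\ne 0$, and there is a (real) signed measure $\mathcal M$ on the set of configurations with $\mathcal M(\{\mathcal T\})=Z_N^{-1}W(\mathcal T)$ for every $\mathcal T$. This measure is determinantal: for all $m\ge 0$ and all pairwise distinct points $(n_1,\tau_1),\dots,(n_m,\tau_m)$ of $\{1,\dots,N\}\times\mathbb{Z}_{\ge x}$, $$\mathcal M\big(\{\mathcal T:(n_1,\tau_1),\dots,(n_m,\tau_m)\in\mathcal T\}\big)=\det\big[K(n_i,\tau_i;n_j,\tau_j)\big]_{i,j=1}^m,$$ where $$K(n_1,\tau_1;n_2,\tau_2)=p\oint_{\Gamma_1}\frac{dv}{2\pi i v}\oint_{\Gamma_{0,v}}\frac{dw}{2\pi i w}\,\frac{\big(1-p\frac{w-1}{w}\big)^{\tau_1}\big(\frac{w-1}{w}\big)^{n_1}(w/v)^{x+N}}{\big(1-p\frac{v-1}{v}\big)^{\tau_2+1}\big(\frac{v-1}{v}\big)^{n_2}(w-v)}$$ $$\qquad-\mathbf 1(n_2>n_1)\oint_{\Gamma_{1,0}}\frac{p\,dz}{2\pi i z^2}\Big(\frac{z-1}{z}\Big)^{n_1-n_2}\Big(1-p\frac{z-1}{z}\Big)^{\tau_1-\tau_2-1}.$$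 Here the contours are any anticlockwise circles such that: $\Gamma_1$ encircles $1$ and leaves $0$ and $-p/q$ outside; $\Gamma_{0,v}$ encircles $0$ and the whole of $\Gamma_1$ and leaves $-p/q$ outside; $\Gamma_{1,0}$ encircles $0$ and $1$ and leaves $-p/q$ outside. -/

import Mathlib

namespace TasepKernel

noncomputable section

open Complex

/-- The factor `1 - p (w - 1) / w = q + p / w`, where `q = 1 - p`. -/
def symb (p : ℝ) (w : ℂ) : ℂ := 1 - p * ((w - 1) / w)

/-- The function `F̃_n(x, t) = (2πi)⁻¹ ∮ dw/w (q + p/w)^t (1 - w)^(-n) w^x`, defined for all `t ∈ ℤ`.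
The contour encircles the pole `w = 0` and leaves the other possible singularities `w = 1` and
`w = -p/q` outside; for `0 < p < 1` the circle `|w| = p/2` is such a contour. -/
def Ftilde (p : ℝ) (n x t : ℤ) : ℂ :=
  (2 * Real.pi * I)⁻¹ *
    ∮ w in C(0, p / 2), w⁻¹ * ((1 - p : ℂ) + p / w) ^ t * (1 - w) ^ (-n) * w ^ x

/-- The functions `Ψ^N_k(t) = (-1)^k F̃_{-k}(x + N - k - 1, t)`. -/
def Psi (p : ℝ) (N : ℕ) (x : ℤ) (k : ℕ) (t : ℤ) : ℂ :=
  (-1) ^ k * Ftilde p (-(k : ℤ)) (x + N - k - 1) t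

/-- The transition function `φ_n(z, y) = p 1(y ≥ z)` (it does not depend on `n`). -/
def phi (p : ℝ) (z y : ℤ) : ℝ := if z ≤ y then p else 0

/-- A configuration `𝒯`: integers `τ^n_i` (written `T n i`), `1 ≤ i ≤ n ≤ N`, in `ℤ_{≥ x}` with
`τ^n_n < τ^n_{n-1} < ⋯ < τ^n_1` for every `n`. Entries outside this index range are set to `0`. -/
structure Config (N : ℕ) (x : ℤ) where
  /-- the entries `τ^n_i` -/
  entry : ℕ → ℕ → ℤ
  lower : ∀ n i, 1 ≤ i → i ≤ n → n ≤ N → x ≤ entry n i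
  strict : ∀ n i j, 1 ≤ i → i < j → j ≤ n → n ≤ N → entry n j < entry n i
  outside : ∀ n i, ¬ (1 ≤ i ∧ i ≤ n ∧ n ≤ N) → entry n i = 0

instance (N : ℕ) (x : ℤ) : CoeFun (Config N x) (fun _ => ℕ → ℕ → ℤ) := ⟨Config.entry⟩

/-- The (countable) space of configurations is discrete: all its subsets are measurable. -/
instance (N : ℕ) (x : ℤ) : MeasurableSpace (Config N x) := ⊤

/-- The finite subset `{(n, τ^n_i) : 1 ≤ i ≤ n ≤ N}` of `{1, …, N} × ℤ_{≥ x}`. -/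
def Config.points {N : ℕ} {x : ℤ} (T : Config N x) : Set (ℕ × ℤ) :=
  {a | a.1 ≤ N ∧ ∃ i, 1 ≤ i ∧ i ≤ a.1 ∧ T a.1 i = a.2}

/-- The matrix `[φ_n(τ^n_i, τ^{n+1}_j)]`, `1 ≤ i, j ≤ n + 1`; its last row `i = n + 1` belongs to the
fictitious variable `τ^n_{n+1}`, for which `φ_n(τ^n_{n+1}, y) = p`. -/
def phiMatrix (p : ℝ) {N : ℕ} {x : ℤ} (T : Config N x) (n : ℕ) :
    Matrix (Fin (n + 1)) (Fin (n + 1)) ℝ :=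
  Matrix.of fun i j => if (i : ℕ) < n then phi p (T n (i + 1)) (T (n + 1) (j + 1)) else p

/-- The matrix `[Ψ^N_i(τ^N_{N-j})]`, `0 ≤ i, j ≤ N - 1`. -/
def PsiMatrix (p : ℝ) {N : ℕ} {x : ℤ} (T : Config N x) : Matrix (Fin N) (Fin N) ℂ :=
  Matrix.of fun i j => Psi p N x i (T N (N - j))

/-- The unnormalized weight of a configuration. -/
def weight (p : ℝ) {N : ℕ} {x : ℤ} (T : Config N x) : ℂ :=
  ((∏ n ∈ Finset.range N, (phiMatrix p T n).det : ℝ) : ℂ) * (PsiMatrix p T).det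

/-- The normalization constant `Z_N`: the sum of all weights. -/
def partitionFunction (p : ℝ) (N : ℕ) (x : ℤ) : ℂ := ∑' T : Config N x, weight p T

/-- `K` is a correlation kernel of the signed measure `M`: for pairwise distinct points
`a_1, …, a_m` of `{1, …, N} × ℤ_{≥ x}` the `m`-point correlation function
`M {T : a_1, …, a_m ∈ T}` is `det [K(a_i, a_j)]`. -/
def IsCorrelationKernel {N : ℕ} {x : ℤ} (M : MeasureTheory.SignedMeasure (Config N x))
    (K : ℕ × ℤ → ℕ × ℤ → ℂ) : Prop :=
  ∀ (m : ℕ) (a : Fin m → ℕ × ℤ), Function.Injective a →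
    (∀ i, 1 ≤ (a i).1 ∧ (a i).1 ≤ N ∧ x ≤ (a i).2) →
    ((M {T | ∀ i, a i ∈ T.points} : ℝ) : ℂ) = (Matrix.of fun i j => K (a i) (a j)).det

/-- The double contour integral, with `v` on the circle `C(c₁, r₁)` and `w` on `C(c₀, r₀)`. -/
def doubleIntegral (p : ℝ) (N : ℕ) (x : ℤ) (c₁ : ℂ) (r₁ : ℝ) (c₀ : ℂ) (r₀ : ℝ)
    (n₁ : ℕ) (τ₁ : ℤ) (n₂ : ℕ) (τ₂ : ℤ) : ℂ :=
  p * ∮ v in C(c₁, r₁), (2 * Real.pi * I * v)⁻¹ *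
    ∮ w in C(c₀, r₀), (2 * Real.pi * I * w)⁻¹ *
      (symb p w ^ τ₁ * ((w - 1) / w) ^ n₁ * (w / v) ^ (x + N) /
        (symb p v ^ (τ₂ + 1) * ((v - 1) / v) ^ n₂ * (w - v)))

/-- The single contour integral, with `z` on the circle `C(c, r)`. -/
def singleIntegral (p : ℝ) (c : ℂ) (r : ℝ) (n₁ : ℕ) (τ₁ : ℤ) (n₂ : ℕ) (τ₂ : ℤ) : ℂ :=
  ∮ z in C(c, r), p / (2 * Real.pi * I * z ^ 2) *
    ((z - 1) / z) ^ ((n₁ : ℤ) - (n₂ : ℤ)) * symb p z ^ (τ₁ - τ₂ - 1)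

/-- The kernel `K(n₁, τ₁; n₂, τ₂)`. -/
def kernel (p : ℝ) (N : ℕ) (x : ℤ) (c₁ : ℂ) (r₁ : ℝ) (c₀ : ℂ) (r₀ : ℝ) (c : ℂ) (r : ℝ)
    (a b : ℕ × ℤ) : ℂ :=
  doubleIntegral p N x c₁ r₁ c₀ r₀ a.1 a.2 b.1 b.2 -
    if a.1 < b.1 then singleIntegral p c r a.1 a.2 b.1 b.2 else 0

end

end TasepKernel

/-! Give every configuration the extra factor `1 + g` for each prescribed point it contains.
Cauchy–Binet sums out one level after another (`sum_truncated_weight`), leaving an `N × N`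
determinant. Its entries carry `Ψ^N_j` down to level `i`, position `x`, by the one-sided summation
`f ↦ p ∑_{y ≥ z} f y`. Sums are first cut off at `L`. Decay of `Ψ` like `(1 - p/2)^t`, seen on the
circle `|w| = 2`, gives absolute convergence and the limit `L → ∞`.

Without extra factors, going down one level divides the integrand by `(w - 1)/w`
(`psiInt_sub_psiInt`), so the entries tend to the explicit integrals `psiInt`. Their matrix `M` is
unit triangular up to reversal of columns, hence `Z_N ≠ 0`.

With the factors, a Duhamel expansion (`descend_pointWeight`) perturbs `M` by `g T (1 - gΦ)⁻¹ B`.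
Here `Φ` holds the transition functions between the points, `T` those from the bottom to the points,
and `B` the values of `Ψ` at the points. Since `Φ` strictly raises the level, `det (1 - gΦ) = 1`.
Whenever `T = M Q`, the determinant equals `det M * det (1 + g (B Q - Φ))` (`det_add_smul_mul`).

The integrals `phiInt` provide such a `Q`. A finite geometric expansion of `1/(w - v)` writes the
double integral as `∑_j Ψ_j Φ_j` (`doubleIntegral_eq_sum`), so `B Q - Φ` is the kernel matrix. The
same double integral at a bottom point `(i, x)` collapses to its residue at `w = v`, which is the
transition function; this is `M Q = T`. Finally `g → ∞`, after rescaling, selects the configurations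
that contain all the points (`tsum_weight_ite_mem`). -/

namespace TasepKernel

open Finset Matrix

/-! ### Sums over decreasing tuples and the Andréief identity. -/

section Tuples

open scoped Classical in
/-- The strictly decreasing `n`-tuples with entries in `X`. -/
noncomputable def strictTuples (X : Finset ℤ) (n : ℕ) : Finset (Fin n → ℤ) :=
  (Fintype.piFinset fun _ => X).filter StrictAnti

theorem mem_strictTuples {X : Finset ℤ} {n : ℕ} {τ : Fin n → ℤ} :
    τ ∈ strictTuples X n ↔ (∀ i, τ i ∈ X) ∧ StrictAnti τ := by
  simp [strictTuples, Fintype.mem_piFinset]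

theorem exists_perm_strictAnti {n : ℕ} {τ : Fin n → ℤ} (h : Function.Injective τ) :
    ∃ σ : Equiv.Perm (Fin n), StrictAnti (τ ∘ σ) := by
  refine ⟨Tuple.sort (fun i => -τ i), ?_⟩
  have hm := Tuple.monotone_sort (fun i => -τ i)
  have hs : StrictMono ((fun i => -τ i) ∘ Tuple.sort (fun i => -τ i)) :=
    hm.strictMono_of_injective
      ((neg_injective.comp h).comp (Tuple.sort (fun i => -τ i)).injective)
  intro i j hij
  have := hs hij
  simpa using this

theorem strictAnti_eq_of_comp_perm {n : ℕ} {τ τ' : Fin n → ℤ} (h : StrictAnti τ)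
    (h' : StrictAnti τ') {σ σ' : Equiv.Perm (Fin n)} (e : τ ∘ σ = τ' ∘ σ') : τ = τ' := by
  have hr : Set.range (fun i => -τ i) = Set.range (fun i => -τ' i) := by
    have h1 : Set.range τ = Set.range τ' := by
      rw [← σ.surjective.range_comp τ, e, σ'.surjective.range_comp]
    have : ∀ u : Fin n → ℤ, Set.range (fun i => -u i) = Neg.neg '' Set.range u := fun u => by
      rw [← Set.range_comp]; rfl
    rw [this, this, h1]
  have hn : ∀ {u : Fin n → ℤ}, StrictAnti u → StrictMono fun i => -u i :=
    fun hu i j hij => neg_lt_neg (hu hij)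
  have := (StrictMono.range_inj (hn h) (hn h')).1 hr
  funext i
  simpa using congrFun this i

-- Every injective tuple has exactly one decreasing rearrangement.
open scoped Classical in
theorem sum_strictTuples_perm {M : Type*} [AddCommMonoid M] (X : Finset ℤ) (n : ℕ)
    (G : (Fin n → ℤ) → M) :
    ∑ τ ∈ strictTuples X n, ∑ σ : Equiv.Perm (Fin n), G (τ ∘ σ) =
      ∑ τ ∈ (Fintype.piFinset fun _ => X).filter Function.Injective, G τ := by
  rw [← Finset.sum_product']
  refine Finset.sum_bij (fun a _ => a.1 ∘ a.2) ?_ ?_ ?_ (fun _ _ => rfl)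
  · rintro ⟨τ, σ⟩ h
    simp only [mem_product, mem_strictTuples, mem_univ, and_true] at h
    simp only [mem_filter, Fintype.mem_piFinset]
    exact ⟨fun i => h.1 _, h.2.injective.comp σ.injective⟩
  · rintro ⟨τ, σ⟩ h ⟨τ', σ'⟩ h' e
    simp only [mem_product, mem_strictTuples, mem_univ, and_true] at h h'
    have e1 := strictAnti_eq_of_comp_perm h.2 h'.2 e
    subst e1
    refine Prod.ext rfl (Equiv.ext fun i => h.2.injective (congrFun e i))
  · intro τ h
    simp only [mem_filter, Fintype.mem_piFinset] at h
    obtain ⟨σ, hσ⟩ := exists_perm_strictAnti h.2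
    refine ⟨(τ ∘ σ, σ.symm), ?_, ?_⟩
    · simp only [mem_product, mem_strictTuples, mem_univ, and_true]
      exact ⟨fun i => h.1 _, hσ⟩
    · funext i; simp

/-- The Andréief (Cauchy–Binet) identity. -/
theorem sum_strictTuples_det_mul_det (X : Finset ℤ) {n : ℕ} (a f : Fin n → ℤ → ℂ) :
    ∑ τ ∈ strictTuples X n,
        (Matrix.of fun i j => a i (τ j)).det * (Matrix.of fun i j => f j (τ i)).det =
      (Matrix.of fun i j => ∑ y ∈ X, a i y * f j y).det := by
  classical
  have hR : (Matrix.of fun i j => ∑ y ∈ X, a i y * f j y).det =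
      ∑ τ ∈ Fintype.piFinset fun _ : Fin n => X,
        (∏ i, a i (τ i)) * (Matrix.of fun i j => f j (τ i)).det := by
    -- Each row is a sum over `y ∈ X`; multilinearity in the rows expands the determinant over all
    -- tuples.
    have h := (Matrix.detRowAlternating (n := Fin n) (R := ℂ)).toMultilinearMap.map_sum_finset
      (fun i y => a i y • fun j => f j y) (fun _ => X)
    have e : (fun i => ∑ y ∈ X, a i y • fun j => f j y) =
        (Matrix.of fun i j => ∑ y ∈ X, a i y * f j y) := by
      funext i j; simp [Finset.sum_apply]
    rw [e] at h
    refine h.trans (Finset.sum_congr rfl fun τ _ => ?_)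
    have := (Matrix.detRowAlternating (n := Fin n) (R := ℂ)).toMultilinearMap.map_smul_univ
      (fun i => a i (τ i)) (fun i j => f j (τ i))
    rw [smul_eq_mul] at this
    exact this
  -- Tuples with a repeated entry give two equal rows and drop out; the injective ones are grouped
  -- by their decreasing rearrangement.
  rw [hR, ← Finset.sum_filter_of_ne (s := Fintype.piFinset fun _ : Fin n => X)
    (p := Function.Injective), ← sum_strictTuples_perm]
  · refine Finset.sum_congr rfl fun τ _ => ?_
    have hp : ∀ σ : Equiv.Perm (Fin n), (Matrix.of fun i j => f j ((τ ∘ σ) i)).det =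
        (Equiv.Perm.sign σ : ℂ) * (Matrix.of fun i j => f j (τ i)).det :=
      fun σ => Matrix.det_permute σ (Matrix.of fun i j => f j (τ i))
    simp only [hp]
    rw [← Matrix.det_transpose, Matrix.det_apply', Finset.sum_mul]
    refine Finset.sum_congr rfl fun σ _ => ?_
    simp only [Matrix.transpose_apply, Matrix.of_apply, Function.comp]
    ring
  · intro τ _ hne
    by_contra hinj
    refine hne ?_
    simp only [Function.Injective, not_forall] at hinj
    obtain ⟨i, j, hij, hne'⟩ := hinj
    rw [Matrix.det_zero_of_row_eq hne' (by funext k; simp [hij]), mul_zero]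

/-- The Leibniz formula bounds the determinant by a permanent. Permanents summed over decreasing
tuples give a sum over injective tuples, hence at most the sum over all tuples, which factors. -/
theorem sum_strictTuples_abs_det_le (X : Finset ℤ) {n : ℕ} (b : Fin n → ℤ → ℝ)
    (hb : ∀ i y, 0 ≤ b i y) :
    ∑ τ ∈ strictTuples X n, |(Matrix.of fun i j => b i (τ j)).det| ≤
      ∏ i, ∑ y ∈ X, b i y := by
  classical
  calc ∑ τ ∈ strictTuples X n, |(Matrix.of fun i j => b i (τ j)).det|
      ≤ ∑ τ ∈ strictTuples X n, ∑ σ : Equiv.Perm (Fin n), ∏ i, b i ((τ ∘ σ) i) := by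
        refine Finset.sum_le_sum fun τ _ => ?_
        rw [← Matrix.det_transpose, Matrix.det_apply]
        refine (Finset.abs_sum_le_sum_abs _ _).trans (Finset.sum_le_sum fun σ _ => ?_)
        rw [Units.smul_def, zsmul_eq_mul, abs_mul, Finset.abs_prod]
        have h1 : |((Equiv.Perm.sign σ : ℤ) : ℝ)| = 1 := by
          rcases Int.units_eq_one_or (Equiv.Perm.sign σ) with h | h <;> simp [h]
        rw [h1, one_mul]
        refine (Finset.prod_congr rfl fun i _ => ?_).le
        simp [abs_of_nonneg (hb _ _)]
    _ = ∑ τ ∈ (Fintype.piFinset fun _ => X).filter Function.Injective, ∏ i, b i (τ i) :=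
        sum_strictTuples_perm X n fun τ => ∏ i, b i (τ i)
    _ ≤ ∑ τ ∈ Fintype.piFinset fun _ : Fin n => X, ∏ i, b i (τ i) :=
        Finset.sum_le_sum_of_subset_of_nonneg (Finset.filter_subset _ _)
          fun τ _ _ => Finset.prod_nonneg fun i _ => hb _ _
    _ = ∏ i, ∑ y ∈ X, b i y := (Finset.prod_univ_sum _ _).symm

end Tuples

/-! ### Building configurations level by level, and finite truncations. -/

section Configurations

variable {N : ℕ} {x : ℤ}

theorem Config.ext_entry {T T' : Config N x} (h : T.entry = T'.entry) : T = T' := by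
  cases T; cases T'; cases h; rfl

/-- Adjoin a top level to a configuration. -/
def Config.snoc (T : Config N x) (τ : Fin (N + 1) → ℤ) (hτ : StrictAnti τ)
    (hx : ∀ i, x ≤ τ i) : Config (N + 1) x where
  -- Entries count from `1`, the tuple from `0`. Outside the index range `T` itself supplies the
  -- default `0`.
  entry n i := if h : n = N + 1 ∧ 1 ≤ i ∧ i ≤ N + 1 then τ ⟨i - 1, by omega⟩ else T n i
  lower n i h1 h2 h3 := by
    split_ifs with h
    · exact hx _
    · exact T.lower n i h1 h2 (by omega)
  strict n i j h1 h2 h3 h4 := by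
    by_cases h : n = N + 1
    · rw [dif_pos ⟨h, by omega, by omega⟩, dif_pos ⟨h, by omega, by omega⟩]
      exact hτ (by simp only [Fin.mk_lt_mk]; omega)
    · rw [dif_neg (by omega), dif_neg (by omega)]
      exact T.strict n i j h1 h2 h3 (by omega)
  outside n i h := by
    rw [dif_neg (by omega)]
    exact T.outside n i (by omega)

theorem Config.snoc_of_le (T : Config N x) {τ : Fin (N + 1) → ℤ} (hτ : StrictAnti τ)
    (hx : ∀ i, x ≤ τ i) {n : ℕ} (hn : n ≤ N) (i : ℕ) : T.snoc τ hτ hx n i = T n i :=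
  dif_neg (by omega)

theorem Config.snoc_top (T : Config N x) {τ : Fin (N + 1) → ℤ} (hτ : StrictAnti τ)
    (hx : ∀ i, x ≤ τ i) (i : Fin (N + 1)) : T.snoc τ hτ hx (N + 1) (i + 1) = τ i := by
  refine (dif_pos ⟨rfl, by omega, by omega⟩).trans ?_
  congr 1

/-- Remove the top level of a configuration. -/
def Config.init (T : Config (N + 1) x) : Config N x where
  entry n i := if n = N + 1 then 0 else T n i
  lower n i h1 h2 h3 := by rw [if_neg (by omega)]; exact T.lower n i h1 h2 (by omega)
  strict n i j h1 h2 h3 h4 := by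
    rw [if_neg (by omega), if_neg (by omega)]; exact T.strict n i j h1 h2 h3 (by omega)
  outside n i h := by
    split_ifs with h'
    · rfl
    · exact T.outside n i (by omega)

theorem Config.strictAnti_level (T : Config N x) {n : ℕ} (hn : n ≤ N) :
    StrictAnti fun i : Fin n => T n (i + 1) := fun i j hij =>
  T.strict n _ _ (by omega) (by simpa using hij) (by omega) hn

theorem Config.snoc_init (T : Config (N + 1) x) :
    T.init.snoc (fun i => T (N + 1) (i + 1)) (T.strictAnti_level le_rfl)
      (fun i => T.lower _ _ (by omega) (by omega) le_rfl) = T := by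
  refine Config.ext_entry ?_
  funext n i
  by_cases h : n = N + 1 ∧ 1 ≤ i ∧ i ≤ N + 1
  · obtain ⟨rfl, h1, h2⟩ := h
    refine (dif_pos ⟨rfl, h1, h2⟩).trans ?_
    simp only
    congr 1
    omega
  · refine (dif_neg h).trans ?_
    show (if n = N + 1 then 0 else T n i) = T n i
    split_ifs with h'
    · exact (T.outside n i (by omega)).symm
    · rfl

theorem Config.snoc_injective {T T' : Config N x} {τ τ' : Fin (N + 1) → ℤ} {hτ hτ'} {hx hx'}
    (h : T.snoc τ hτ hx = T'.snoc τ' hτ' hx') : T = T' ∧ τ = τ' := by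
  constructor
  · refine Config.ext_entry ?_
    funext n i
    by_cases hn : n ≤ N
    · rw [← T.snoc_of_le hτ hx hn, h, T'.snoc_of_le hτ' hx' hn]
    · rw [T.outside n i (by omega), T'.outside n i (by omega)]
  · funext i
    rw [← T.snoc_top hτ hx, h, T'.snoc_top hτ' hx']

/-- The configuration without points. -/
def Config.empty (x : ℤ) : Config 0 x where
  entry _ _ := 0
  lower := by omega
  strict := by omega
  outside _ _ _ := rfl

theorem Config.eq_empty (T : Config 0 x) : T = Config.empty x :=
  Config.ext_entry (by funext n i; exact T.outside n i (by omega))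

open scoped Classical in
/-- The finite set of configurations all of whose points lie below `L`. -/
noncomputable def truncated (x L : ℤ) : (N : ℕ) → Finset (Config N x)
  | 0 => {Config.empty x}
  | N + 1 => (truncated x L N ×ˢ (strictTuples (Ico x L) (N + 1)).attach).image fun a =>
      a.1.snoc a.2.1 (mem_strictTuples.1 a.2.2).2
        fun i => (mem_Ico.1 ((mem_strictTuples.1 a.2.2).1 i)).1

theorem mem_truncated {L : ℤ} {T : Config N x} :
    T ∈ truncated x L N ↔ ∀ n i, 1 ≤ i → i ≤ n → n ≤ N → T n i < L := by
  induction N with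
  | zero => simp only [truncated, mem_singleton, T.eq_empty, true_iff]; omega
  | succ N ih =>
    simp only [truncated, mem_image, mem_product, mem_attach, and_true, Prod.exists,
      Subtype.exists]
    constructor
    · rintro ⟨T', τ, hτ, hT', rfl⟩ n i h1 h2 h3
      by_cases hn : n ≤ N
      · rw [Config.snoc_of_le _ _ _ hn]
        exact ih.1 hT' n i h1 h2 hn
      · obtain rfl : n = N + 1 := by omega
        obtain ⟨i, rfl⟩ : ∃ k, i = k + 1 := ⟨i - 1, by omega⟩
        have := Config.snoc_top T' (mem_strictTuples.1 hτ).2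
          (fun i => (mem_Ico.1 ((mem_strictTuples.1 hτ).1 i)).1) ⟨i, by omega⟩
        simp only at this
        rw [this]
        exact (mem_Ico.1 ((mem_strictTuples.1 hτ).1 _)).2
    · intro h
      refine ⟨T.init, fun i => T (N + 1) (i + 1), ?_, ?_, T.snoc_init⟩
      · refine mem_strictTuples.2 ⟨fun i => mem_Ico.2 ⟨?_, ?_⟩, T.strictAnti_level le_rfl⟩
        · exact T.lower _ _ (by omega) (by omega) le_rfl
        · exact h _ _ (by omega) (by omega) le_rfl
      · refine ih.2 fun n i h1 h2 h3 => ?_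
        show (if n = N + 1 then 0 else T n i) < L
        rw [if_neg (by omega)]
        exact h n i h1 h2 (by omega)

/-- Letting `G` see the top level as a bare tuple removes the proofs stored in `Config.snoc` from
the sum. -/
theorem sum_truncated_succ {M : Type*} [AddCommMonoid M] (L : ℤ) (F : Config (N + 1) x → M)
    (G : Config N x → (Fin (N + 1) → ℤ) → M)
    (hFG : ∀ T τ hτ hx, F (Config.snoc T τ hτ hx) = G T τ) :
    ∑ T ∈ truncated x L (N + 1), F T =
      ∑ T ∈ truncated x L N, ∑ τ ∈ strictTuples (Ico x L) (N + 1), G T τ := by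
  classical
  rw [truncated, Finset.sum_image, Finset.sum_product]
  · refine Finset.sum_congr rfl fun T _ => ?_
    simp only [hFG]
    exact Finset.sum_attach _ fun τ => G T τ
  · rintro ⟨T, τ, hτ⟩ _ ⟨T', τ', hτ'⟩ _ h
    obtain ⟨rfl, h2⟩ := Config.snoc_injective h
    simp only at h2
    subst h2
    rfl

end Configurations

/-! ### Summing out the levels: the total weight as one determinant. -/

section Weights

variable {N : ℕ} {x : ℤ}

/-- The truncated operator `f ↦ (z ↦ ∑_y φ(z, y) f(y))`. -/
noncomputable def stepSum (p : ℝ) (L : ℤ) (f : ℤ → ℂ) (z : ℤ) : ℂ := p * ∑ y ∈ Ico z L, f y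

/-- Starting from a function on level `N`, descend `k` levels, with weight `D n y` at each
summation point `(n, y)`. -/
noncomputable def descend (p : ℝ) (D : ℕ → ℤ → ℂ) (L : ℤ) (N : ℕ) : ℕ → (ℤ → ℂ) → ℤ → ℂ
  | 0, f => f
  | k + 1, f => stepSum p L fun y => D (N - k) y * descend p D L N k f y

/-- By definition the outermost step of `descend` is the lowest level, whereas induction on `N`
strips the top level; this is the recursion at the other end. -/
theorem descend_succ_left (p : ℝ) (D : ℕ → ℤ → ℂ) (L : ℤ) (N k : ℕ) (f : ℤ → ℂ) :
    descend p D L (N + 1) (k + 1) f =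
      descend p D L N k (stepSum p L fun y => D (N + 1) y * f y) := by
  induction k with
  | zero => rfl
  | succ k ih =>
    rw [descend, ih]
    simp only [descend, Nat.add_sub_add_right]

theorem sum_phi_mul (p : ℝ) {x z L : ℤ} (hz : x ≤ z) (g : ℤ → ℂ) :
    ∑ y ∈ Ico x L, (phi p z y : ℂ) * g y = stepSum p L g z := by
  rw [stepSum, Finset.mul_sum]
  have : Ico z L = (Ico x L).filter fun y => z ≤ y := by ext y; simp; omega
  rw [this, Finset.sum_filter]
  refine Finset.sum_congr rfl fun y _ => ?_
  unfold phi
  split_ifs <;> simp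

theorem phiMatrix_snoc (p : ℝ) (T : Config N x) {τ : Fin (N + 1) → ℤ} (hτ hx) {n : ℕ}
    (hn : n < N) : phiMatrix p (T.snoc τ hτ hx) n = phiMatrix p T n := by
  ext i j
  simp only [phiMatrix, Matrix.of_apply]
  rw [T.snoc_of_le hτ hx hn.le, T.snoc_of_le hτ hx (show n + 1 ≤ N by omega)]

theorem phiMatrix_snoc_top (p : ℝ) (T : Config N x) {τ : Fin (N + 1) → ℤ} (hτ hx) :
    phiMatrix p (T.snoc τ hτ hx) N =
      Matrix.of fun i j : Fin (N + 1) =>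
        if (i : ℕ) < N then phi p (T N (i + 1)) (τ j) else p := by
  ext i j
  simp only [phiMatrix, Matrix.of_apply]
  rw [T.snoc_of_le hτ hx le_rfl, T.snoc_top hτ hx]

/-- Andréief with `D` absorbed into the functions `f j`. All summation points are at least `x`, so
the constant row of the fictitious variable acts like `phi p x`: that variable sits effectively at
`x`. -/
theorem sum_top_level (p : ℝ) (D : ℤ → ℂ) (L : ℤ) (T : Config N x) (f : Fin (N + 1) → ℤ → ℂ) :
    ∑ τ ∈ strictTuples (Ico x L) (N + 1),
      (((Matrix.of fun i j : Fin (N + 1) =>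
        if (i : ℕ) < N then phi p (T N (i + 1)) (τ j) else p).det : ℝ) : ℂ) *
        (∏ i, D (τ i)) * (Matrix.of fun i j => f j (τ i)).det =
      (Matrix.of fun i j : Fin (N + 1) => if (i : ℕ) < N then
        stepSum p L (fun y => D y * f j y) (T N (i + 1))
        else stepSum p L (fun y => D y * f j y) x).det := by
  have h := sum_strictTuples_det_mul_det (Ico x L)
    (fun (i : Fin (N + 1)) y => ((if (i : ℕ) < N then phi p (T N (i + 1)) y else p : ℝ) : ℂ))
    (fun j y => D y * f j y)
  have e : (Matrix.of fun i j : Fin (N + 1) => if (i : ℕ) < N then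
        stepSum p L (fun y => D y * f j y) (T N (i + 1))
        else stepSum p L (fun y => D y * f j y) x) = (Matrix.of fun i j : Fin (N + 1) =>
        ∑ y ∈ Ico x L, ((if (i : ℕ) < N then phi p (T N (i + 1)) y else p : ℝ) : ℂ) *
          (D y * f j y)) := by
    ext i j
    simp only [Matrix.of_apply]
    split_ifs with hi
    · exact (sum_phi_mul p (T.lower _ _ (by omega) (by omega) le_rfl) _).symm
    · rw [stepSum, Finset.mul_sum]
  rw [e, ← h]
  refine Finset.sum_congr rfl fun τ _ => ?_
  rw [mul_assoc]
  congr 1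
  · rw [← Complex.ofRealHom_eq_coe, RingHom.map_det]
    rfl
  · exact (Matrix.det_mul_column (fun i => D (τ i)) (Matrix.of fun i j => f j (τ i))).symm

/-- The weighted sum over truncated configurations is a determinant. -/
theorem sum_truncated_weight (p : ℝ) (D : ℕ → ℤ → ℂ) (L : ℤ) (N : ℕ) (f : Fin N → ℤ → ℂ) :
    ∑ T ∈ truncated x L N, (∏ n ∈ range N, (((phiMatrix p T n).det : ℝ) : ℂ)) *
        (∏ n ∈ range N, ∏ i : Fin (n + 1), D (n + 1) (T (n + 1) (i + 1))) *
        (Matrix.of fun i j : Fin N => f j (T N (i + 1))).det =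
      (Matrix.of fun i j : Fin N => descend p D L N (N - i) (f j) x).det := by
  induction N with
  | zero => simp [truncated]
  | succ N ih =>
    rw [sum_truncated_succ L _ fun T τ =>
      ((∏ n ∈ range N, (((phiMatrix p T n).det : ℝ) : ℂ)) *
        (∏ n ∈ range N, ∏ i : Fin (n + 1), D (n + 1) (T (n + 1) (i + 1)))) *
        ((((Matrix.of fun i j : Fin (N + 1) =>
        if (i : ℕ) < N then phi p (T N (i + 1)) (τ j) else p).det : ℝ) : ℂ) *
        (∏ i, D (N + 1) (τ i)) * (Matrix.of fun i j => f j (τ i)).det)]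
    · simp only [← Finset.mul_sum, sum_top_level]
      set h : Fin (N + 1) → ℤ → ℂ := fun j => stepSum p L fun y => D (N + 1) y * f j y with hh
      -- The fictitious last row does not depend on the configuration. Laplace expansion along it
      -- leaves `N × N` determinants with one function omitted, to which the induction hypothesis
      -- applies.
      have hexp : ∀ r : Fin N → Fin (N + 1) → ℂ,
          (Matrix.of fun i j : Fin (N + 1) =>
            if hi : (i : ℕ) < N then r ⟨i, hi⟩ j else h j x).det =
          ∑ j : Fin (N + 1), (-1) ^ (N + (j : ℕ)) * h j x *
            (Matrix.of fun i k : Fin N => r i (j.succAbove k)).det := by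
        intro r
        rw [Matrix.det_succ_row _ (Fin.last N)]
        refine Finset.sum_congr rfl fun j _ => ?_
        congr 2
        · simp
        · ext i k
          simp
      have e1 : ∀ T : Config N x, (Matrix.of fun i j : Fin (N + 1) => if (i : ℕ) < N then
          h j (T N (i + 1)) else h j x).det = ∑ j : Fin (N + 1), (-1) ^ (N + (j : ℕ)) * h j x *
            (Matrix.of fun i k : Fin N => h (j.succAbove k) (T N (i + 1))).det := fun T =>
        hexp fun i j => h j (T N (i + 1))
      have e2 : (Matrix.of fun i j : Fin (N + 1) =>
          descend p D L (N + 1) (N + 1 - i) (f j) x).det =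
          ∑ j : Fin (N + 1), (-1) ^ (N + (j : ℕ)) * h j x *
            (Matrix.of fun i k : Fin N =>
              descend p D L N (N - i) (h (j.succAbove k)) x).det := by
        rw [← hexp fun i j => descend p D L N (N - i) (h j) x]
        congr 1
        ext i j
        simp only [Matrix.of_apply]
        split_ifs with hi
        · rw [show N + 1 - (i : ℕ) = (N - i) + 1 by omega, descend_succ_left]
        · rw [show N + 1 - (i : ℕ) = 0 + 1 by omega, descend_succ_left]
          rfl
      rw [e2]
      change ∑ T ∈ truncated x L N, _ * (Matrix.of fun i j : Fin (N + 1) => if (i : ℕ) < N then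
          h j (T N (i + 1)) else h j x).det = _
      simp only [e1, ← ih, Finset.mul_sum]
      rw [Finset.sum_comm]
      refine Finset.sum_congr rfl fun j _ => Finset.sum_congr rfl fun T _ => ?_
      ring
    · intro T τ hτ hx
      simp only [Finset.prod_range_succ, phiMatrix_snoc_top, T.snoc_top hτ hx]
      have a1 : ∏ n ∈ range N, (((phiMatrix p (T.snoc τ hτ hx) n).det : ℝ) : ℂ) =
          ∏ n ∈ range N, (((phiMatrix p T n).det : ℝ) : ℂ) :=
        Finset.prod_congr rfl fun n hn => by rw [phiMatrix_snoc p T hτ hx (mem_range.1 hn)]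
      have a2 : ∏ n ∈ range N, ∏ i : Fin (n + 1),
          D (n + 1) (T.snoc τ hτ hx (n + 1) (i + 1)) =
          ∏ n ∈ range N, ∏ i : Fin (n + 1), D (n + 1) (T (n + 1) (i + 1)) :=
        Finset.prod_congr rfl fun n hn => Finset.prod_congr rfl fun i _ => by
          rw [T.snoc_of_le hτ hx (by have := mem_range.1 hn; omega)]
      rw [a1, a2]
      ring

end Weights

/-! ### Absolute bounds, uniform in the truncation. -/

section Bounds

theorem sum_Ico_telescope {M : Type*} [AddCommGroup M] (F : ℤ → M) {z L : ℤ} (h : z ≤ L) :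
    ∑ y ∈ Ico z L, (F y - F (y + 1)) = F z - F L := by
  induction L, h using Int.leInduction with
  | base => simp
  | succ L hL ih =>
    have : Ico z (L + 1) = insert L (Ico z L) := by ext y; simp; omega
    rw [this, Finset.sum_insert (by simp), ih]
    abel

theorem sum_Ico_geometric_le {ρ : ℝ} (h0 : 0 < ρ) (h1 : ρ < 1) (x z L : ℤ) :
    ∑ y ∈ Ico z L, ρ ^ (y - x) ≤ (1 - ρ)⁻¹ * ρ ^ (z - x) := by
  have h1' : 0 < 1 - ρ := by linarith
  rcases le_total z L with h | h
  · have e : ∀ y : ℤ, ρ ^ (y - x) =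
        (1 - ρ)⁻¹ * ρ ^ (y - x) - (1 - ρ)⁻¹ * ρ ^ (y + 1 - x) := by
      intro y
      rw [show y + 1 - x = (y - x) + 1 by ring, zpow_add_one₀ h0.ne']
      field_simp
    rw [Finset.sum_congr rfl fun y _ => e y,
      sum_Ico_telescope (fun y => (1 - ρ)⁻¹ * ρ ^ (y - x)) h]
    have : 0 < (1 - ρ)⁻¹ * ρ ^ (L - x) := by positivity
    linarith
  · rw [Finset.Ico_eq_empty (by omega), Finset.sum_empty]
    positivity

variable {N : ℕ} {x : ℤ}

/-- Geometric weights reproduce themselves: summing `p ρ^(y - x)` over `y ≥ z` costs the factor `κ =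
p / (1 - ρ)` and leaves `ρ^(z - x)`. Summing out the top level thus gives `κ^(N + 1)` and the same
weight one level lower. -/
theorem exists_sum_truncated_abs_le {p : ℝ} (hp : 0 ≤ p) {ρ : ℝ} (h0 : 0 < ρ) (h1 : ρ < 1)
    (N : ℕ) (x : ℤ) : ∃ C, ∀ L, ∑ T ∈ truncated x L N,
      |∏ n ∈ range N, (phiMatrix p T n).det| * ∏ i : Fin N, ρ ^ (T N (i + 1) - x) ≤ C := by
  induction N with
  | zero => exact ⟨1, fun L => by simp [truncated]⟩
  | succ N ih =>
    obtain ⟨C, hC⟩ := ih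
    set κ : ℝ := p * (1 - ρ)⁻¹ with hκ
    have hκ0 : 0 ≤ κ := mul_nonneg hp (inv_nonneg.2 (by linarith))
    refine ⟨κ ^ (N + 1) * C, fun L => ?_⟩
    rw [sum_truncated_succ L _ fun T τ => |∏ n ∈ range N, (phiMatrix p T n).det| *
      |(Matrix.of fun i j : Fin (N + 1) =>
        (if (i : ℕ) < N then phi p (T N (i + 1)) (τ j) else p) * ρ ^ (τ j - x)).det|]
    · have hb : ∀ T : Config N x, ∑ τ ∈ strictTuples (Ico x L) (N + 1),
          |(Matrix.of fun i j : Fin (N + 1) =>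
            (if (i : ℕ) < N then phi p (T N (i + 1)) (τ j) else p) * ρ ^ (τ j - x)).det| ≤
          κ ^ (N + 1) * ∏ i : Fin N, ρ ^ (T N (i + 1) - x) := by
        intro T
        refine (sum_strictTuples_abs_det_le (Ico x L) (fun (i : Fin (N + 1)) y =>
          (if (i : ℕ) < N then phi p (T N (i + 1)) y else p) * ρ ^ (y - x)) ?_).trans ?_
        · intro i y
          refine mul_nonneg ?_ (by positivity)
          unfold phi
          split_ifs <;> simp [hp]
        · have key : ∀ z, x ≤ z → ∑ y ∈ Ico x L, phi p z y * ρ ^ (y - x) ≤ κ * ρ ^ (z - x) := by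
            intro z hz
            have e : ∑ y ∈ Ico x L, phi p z y * ρ ^ (y - x) =
                p * ∑ y ∈ Ico z L, ρ ^ (y - x) := by
              have : Ico z L = (Ico x L).filter fun y => z ≤ y := by ext y; simp; omega
              rw [Finset.mul_sum, this, Finset.sum_filter]
              refine Finset.sum_congr rfl fun y _ => ?_
              unfold phi
              split_ifs <;> simp
            rw [e, hκ, mul_assoc]
            exact mul_le_mul_of_nonneg_left (sum_Ico_geometric_le h0 h1 x z L) hp
          rw [Fin.prod_univ_castSucc, pow_succ, mul_right_comm]
          have hnn : ∀ z, 0 ≤ ∑ y ∈ Ico x L, phi p z y * ρ ^ (y - x) := fun z =>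
            Finset.sum_nonneg fun y _ => mul_nonneg (by unfold phi; split_ifs <;> simp [hp])
              (by positivity)
          refine mul_le_mul ?_ ?_ ?_ ?_
          · have : κ ^ N * ∏ i : Fin N, ρ ^ (T N (i + 1) - x) =
                ∏ i : Fin N, κ * ρ ^ (T N (i + 1) - x) := by
              rw [Finset.prod_mul_distrib]; simp
            rw [this]
            refine Finset.prod_le_prod (fun i _ => ?_) fun i _ => ?_
            · simpa using hnn _
            · simpa using key _ (T.lower _ _ (by omega) (by omega) le_rfl)
          · simp only [Fin.val_last, lt_irrefl, if_false, ← Finset.mul_sum]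
            rw [hκ]
            refine mul_le_mul_of_nonneg_left ?_ hp
            simpa using sum_Ico_geometric_le h0 h1 x x L
          · exact Finset.sum_nonneg fun y _ => mul_nonneg (by simp [hp]) (by positivity)
          · positivity
      calc _ = ∑ T ∈ truncated x L N, |∏ n ∈ range N, (phiMatrix p T n).det| *
            ∑ τ ∈ strictTuples (Ico x L) (N + 1), |(Matrix.of fun i j : Fin (N + 1) =>
            (if (i : ℕ) < N then phi p (T N (i + 1)) (τ j) else p) * ρ ^ (τ j - x)).det| := by
            simp only [Finset.mul_sum]
        _ ≤ ∑ T ∈ truncated x L N, |∏ n ∈ range N, (phiMatrix p T n).det| *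
            (κ ^ (N + 1) * ∏ i : Fin N, ρ ^ (T N (i + 1) - x)) :=
            Finset.sum_le_sum fun T _ => mul_le_mul_of_nonneg_left (hb T) (abs_nonneg _)
        _ = κ ^ (N + 1) * ∑ T ∈ truncated x L N, |∏ n ∈ range N, (phiMatrix p T n).det| *
            ∏ i : Fin N, ρ ^ (T N (i + 1) - x) := by
            rw [Finset.mul_sum]
            exact Finset.sum_congr rfl fun T _ => by ring
        _ ≤ _ := mul_le_mul_of_nonneg_left (hC L) (by positivity)
    · intro T τ hτ hx
      rw [Finset.prod_range_succ, phiMatrix_snoc_top, abs_mul, mul_assoc]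
      have a1 : ∏ n ∈ range N, (phiMatrix p (T.snoc τ hτ hx) n).det =
          ∏ n ∈ range N, (phiMatrix p T n).det :=
        Finset.prod_congr rfl fun n hn => by rw [phiMatrix_snoc p T hτ hx (mem_range.1 hn)]
      rw [a1]
      congr 1
      have : (Matrix.of fun i j : Fin (N + 1) =>
          (if (i : ℕ) < N then phi p (T N (i + 1)) (τ j) else p) * ρ ^ (τ j - x)).det =
          (∏ i : Fin (N + 1), ρ ^ (τ i - x)) * (Matrix.of fun i j : Fin (N + 1) =>
          (if (i : ℕ) < N then phi p (T N (i + 1)) (τ j) else p)).det := by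
        rw [← Matrix.det_mul_row]
        congr 1
        ext i j
        simp [mul_comm]
      have hnn : 0 ≤ ∏ i : Fin (N + 1), ρ ^ (τ i - x) :=
        Finset.prod_nonneg fun i _ => by positivity
      rw [this, abs_mul, abs_of_nonneg hnn, mul_comm]
      congr 1
      exact Finset.prod_congr rfl fun i _ => by rw [T.snoc_top hτ hx]

end Bounds

end TasepKernel

namespace TasepKernel

open Complex Metric Set

/-! ### Independence of the circle for integrands with one or two poles. -/

section CircleComparison

variable {U : Set ℂ} {a b c c' : ℂ} {r r' : ℝ} {f : ℂ → ℂ}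

theorem sub_ne_zero_of_mem_sphere {z : ℂ} (ha : a ∈ ball c r) (hz : z ∈ sphere c r) :
    z - a ≠ 0 := by
  refine sub_ne_zero.2 ?_
  rintro rfl
  rw [mem_ball] at ha
  rw [mem_sphere] at hz
  linarith

theorem circleIntegral_eq_zero_of_differentiableOn (hr : 0 ≤ r)
    (hf : DifferentiableOn ℂ f (closedBall c r)) : ∮ w in C(c, r), f w = 0 :=
  (hf.mono closure_ball_subset_closedBall).diffContOnCl.circleIntegral_eq_zero hr

theorem circleIntegral_inv_pow (ha : a ∈ ball c r) (m : ℕ) :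
    ∮ w in C(c, r), ((w - a) ^ (m + 1))⁻¹ = if m = 0 then 2 * Real.pi * I else 0 := by
  split_ifs with h
  · subst h
    simpa using circleIntegral.integral_sub_inv_of_mem_ball ha
  · have := circleIntegral.integral_sub_zpow_of_ne (n := -((m : ℤ) + 1)) (by omega) c a r
    rw [← this]
    congr 1

/-- Writing `f w = f a + (w - a) * dslope f a w` splits off a term whose integral is the same over
every circle around `a` and lowers the pole order by one, since `dslope f a` is again holomorphic on
`U`. -/
theorem circleIntegral_inv_pow_mul_eq (hU : IsOpen U) (hc : closedBall c r ⊆ U)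
    (hc' : closedBall c' r' ⊆ U) (ha : a ∈ ball c r) (ha' : a ∈ ball c' r') (m : ℕ)
    (hf : DifferentiableOn ℂ f U) :
    ∮ w in C(c, r), ((w - a) ^ m)⁻¹ * f w = ∮ w in C(c', r'), ((w - a) ^ m)⁻¹ * f w := by
  have hr : 0 ≤ r := (pos_of_mem_ball ha).le
  have hr' : 0 ≤ r' := (pos_of_mem_ball ha').le
  induction m generalizing f with
  | zero =>
    simp only [pow_zero, inv_one, one_mul]
    rw [circleIntegral_eq_zero_of_differentiableOn hr (hf.mono hc),
      circleIntegral_eq_zero_of_differentiableOn hr' (hf.mono hc')]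
  | succ m ih =>
    have hd : DifferentiableOn ℂ (dslope f a) U :=
      (differentiableOn_dslope (hU.mem_nhds (hc (ball_subset_closedBall ha)))).2 hf
    have key : ∀ {c : ℂ} {r : ℝ}, closedBall c r ⊆ U → a ∈ ball c r → 0 ≤ r →
        ∮ w in C(c, r), ((w - a) ^ (m + 1))⁻¹ * f w =
          f a * (if m = 0 then 2 * Real.pi * I else 0) +
            ∮ w in C(c, r), ((w - a) ^ m)⁻¹ * dslope f a w := by
      intro c r hc ha hr
      have hpow : ∀ k : ℕ, ContinuousOn (fun w => ((w - a) ^ k)⁻¹) (sphere c r) := fun k =>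
        ContinuousOn.inv₀ (by fun_prop) fun z hz =>
          pow_ne_zero _ (sub_ne_zero_of_mem_sphere ha hz)
      rw [← circleIntegral_inv_pow ha m, ← circleIntegral.integral_const_mul,
        ← circleIntegral.integral_add]
      · refine circleIntegral.integral_congr hr fun z hz => ?_
        have hz' := sub_ne_zero_of_mem_sphere ha hz
        have hs : (z - a) * dslope f a z = f z - f a := by
          simpa using sub_smul_dslope f a z
        have : f z = f a + (z - a) * dslope f a z := by rw [hs]; ring
        rw [this, pow_succ]
        field_simp
      · exact (continuousOn_const.mul (hpow _)).circleIntegrable hr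
      · exact ((hpow _).mul (hd.continuousOn.mono
          (sphere_subset_closedBall.trans hc))).circleIntegrable hr
    rw [key hc ha hr, key hc' ha' hr', ih hd]

/-- The partial fraction `1/((w - a)(w - b)) = (1/(w - a) - 1/(w - b))/(a - b)` lowers the total
pole order until only one pole is left. -/
theorem circleIntegral_inv_pow_mul_inv_pow_mul_eq (hU : IsOpen U) (hc : closedBall c r ⊆ U)
    (hc' : closedBall c' r' ⊆ U) (hab : a ≠ b) (ha : a ∈ ball c r) (ha' : a ∈ ball c' r')
    (hb : b ∈ ball c r) (hb' : b ∈ ball c' r') (hf : DifferentiableOn ℂ f U) (k : ℕ) :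
    ∀ m n : ℕ, m + n = k → ∮ w in C(c, r), ((w - a) ^ m)⁻¹ * (((w - b) ^ n)⁻¹ * f w) =
      ∮ w in C(c', r'), ((w - a) ^ m)⁻¹ * (((w - b) ^ n)⁻¹ * f w) := by
  have hr : 0 ≤ r := (pos_of_mem_ball ha).le
  have hr' : 0 ≤ r' := (pos_of_mem_ball ha').le
  induction k with
  | zero =>
    intro m n h
    obtain ⟨rfl, rfl⟩ : m = 0 ∧ n = 0 := by omega
    simpa using circleIntegral_inv_pow_mul_eq hU hc hc' ha ha' 0 hf
  | succ k ih =>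
    intro m n h
    rcases m with _ | m
    · simpa using circleIntegral_inv_pow_mul_eq hU hc hc' hb hb' n hf
    rcases n with _ | n
    · simpa using circleIntegral_inv_pow_mul_eq hU hc hc' ha ha' (m + 1) hf
    have key : ∀ {c : ℂ} {r : ℝ}, closedBall c r ⊆ U → a ∈ ball c r → b ∈ ball c r → 0 ≤ r →
        ∮ w in C(c, r), ((w - a) ^ (m + 1))⁻¹ * (((w - b) ^ (n + 1))⁻¹ * f w) =
          (a - b)⁻¹ * ((∮ w in C(c, r), ((w - a) ^ (m + 1))⁻¹ * (((w - b) ^ n)⁻¹ * f w)) -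
            ∮ w in C(c, r), ((w - a) ^ m)⁻¹ * (((w - b) ^ (n + 1))⁻¹ * f w)) := by
      intro c r hc ha hb hr
      have hpow : ∀ {a}, a ∈ ball c r → ∀ k : ℕ,
          ContinuousOn (fun w => ((w - a) ^ k)⁻¹) (sphere c r) := fun ha k =>
        ContinuousOn.inv₀ (by fun_prop) fun z hz =>
          pow_ne_zero _ (sub_ne_zero_of_mem_sphere ha hz)
      have hci : ∀ i j : ℕ, CircleIntegrable
          (fun w => ((w - a) ^ i)⁻¹ * (((w - b) ^ j)⁻¹ * f w)) c r := fun i j =>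
        ((hpow ha i).mul ((hpow hb j).mul (hf.continuousOn.mono
          (sphere_subset_closedBall.trans hc)))).circleIntegrable hr
      rw [← circleIntegral.integral_sub (hci _ _) (hci _ _),
        ← circleIntegral.integral_const_mul]
      refine circleIntegral.integral_congr hr fun z hz => ?_
      have h1 := sub_ne_zero_of_mem_sphere ha hz
      have h2 := sub_ne_zero_of_mem_sphere hb hz
      have h3 := sub_ne_zero.2 hab
      simp only [pow_succ]
      field_simp
      ring
    rw [key hc ha hb hr, key hc' ha' hb' hr', ih (m + 1) n (by omega), ih m (n + 1) (by omega)]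

theorem zpow_eq_inv_pow_mul_pow {z : ℂ} (hz : z ≠ 0) (e : ℤ) :
    z ^ e = (z ^ (-e).toNat)⁻¹ * z ^ e.toNat := by
  rw [← zpow_natCast, ← zpow_natCast, ← zpow_neg, ← zpow_add₀ hz]
  congr 1
  omega

theorem circleIntegral_zpow_mul_eq (hU : IsOpen U) (hc : closedBall c r ⊆ U)
    (hc' : closedBall c' r' ⊆ U) (ha : a ∈ ball c r) (ha' : a ∈ ball c' r') (e : ℤ)
    (hf : DifferentiableOn ℂ f U) :
    ∮ w in C(c, r), (w - a) ^ e * f w = ∮ w in C(c', r'), (w - a) ^ e * f w := by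
  have key : ∀ {c : ℂ} {r : ℝ}, a ∈ ball c r → ∮ w in C(c, r), (w - a) ^ e * f w =
      ∮ w in C(c, r), ((w - a) ^ (-e).toNat)⁻¹ * ((w - a) ^ e.toNat * f w) := fun ha =>
    circleIntegral.integral_congr (pos_of_mem_ball ha).le fun z hz => by
      simp only [zpow_eq_inv_pow_mul_pow (sub_ne_zero_of_mem_sphere ha hz) e, mul_assoc]
  rw [key ha, key ha']
  exact circleIntegral_inv_pow_mul_eq hU hc hc' ha ha' _
    (DifferentiableOn.mul (by fun_prop) hf)

theorem circleIntegral_zpow_mul_zpow_mul_eq (hU : IsOpen U) (hc : closedBall c r ⊆ U)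
    (hc' : closedBall c' r' ⊆ U) (hab : a ≠ b) (ha : a ∈ ball c r) (ha' : a ∈ ball c' r')
    (hb : b ∈ ball c r) (hb' : b ∈ ball c' r') (e l : ℤ) (hf : DifferentiableOn ℂ f U) :
    ∮ w in C(c, r), (w - a) ^ e * ((w - b) ^ l * f w) =
      ∮ w in C(c', r'), (w - a) ^ e * ((w - b) ^ l * f w) := by
  have key : ∀ {c : ℂ} {r : ℝ}, a ∈ ball c r → b ∈ ball c r →
      ∮ w in C(c, r), (w - a) ^ e * ((w - b) ^ l * f w) =
      ∮ w in C(c, r), ((w - a) ^ (-e).toNat)⁻¹ * (((w - b) ^ (-l).toNat)⁻¹ *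
        ((w - a) ^ e.toNat * ((w - b) ^ l.toNat * f w))) := fun ha hb =>
    circleIntegral.integral_congr (pos_of_mem_ball ha).le fun z hz => by
      simp only [zpow_eq_inv_pow_mul_pow (sub_ne_zero_of_mem_sphere ha hz) e,
        zpow_eq_inv_pow_mul_pow (sub_ne_zero_of_mem_sphere hb hz) l]
      ring
  rw [key ha hb, key ha' hb']
  exact circleIntegral_inv_pow_mul_inv_pow_mul_eq hU hc hc' hab ha ha' hb hb'
    (DifferentiableOn.mul (by fun_prop) (DifferentiableOn.mul (by fun_prop) hf)) _ _ _ rfl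

theorem circleIntegral_sub_inv_mul_of_differentiableOn
    (hf : DifferentiableOn ℂ f (closedBall c r)) (ha : a ∈ ball c r) :
    ∮ w in C(c, r), (w - a)⁻¹ * f w = 2 * Real.pi * I * f a :=
  hf.circleIntegral_sub_inv_smul ha

end CircleComparison

/-! ### The factor `q + p/w` and its singularities. -/

section Symbol

variable {p : ℝ} {w : ℂ}

/-- The numerator `q w + p` of `symb p w`. -/
def symbNum (p : ℝ) (w : ℂ) : ℂ := (1 - p) * w + p

theorem symb_eq_div (hw : w ≠ 0) : symb p w = symbNum p w / w := by
  unfold symb symbNum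
  field_simp
  ring

theorem symbNum_ne_zero (hp : p < 1) (hw : w ≠ (-(p / (1 - p)) : ℂ)) : symbNum p w ≠ 0 := by
  have hq : (1 - p : ℂ) ≠ 0 := by
    rw [sub_ne_zero]; exact_mod_cast hp.ne'
  intro h
  refine hw ?_
  unfold symbNum at h
  field_simp
  linear_combination h

theorem symb_ne_zero (hp : p < 1) (h0 : w ≠ 0) (hw : w ≠ (-(p / (1 - p)) : ℂ)) :
    symb p w ≠ 0 := by
  rw [symb_eq_div h0]
  exact div_ne_zero (symbNum_ne_zero hp hw) h0

@[simp]
theorem symbNum_one : symbNum p 1 = 1 := by simp [symbNum]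

theorem differentiable_symbNum : Differentiable ℂ (symbNum p) := by
  unfold symbNum
  fun_prop

theorem differentiableOn_symbNum_zpow (hp : p < 1) (t : ℤ) :
    DifferentiableOn ℂ (fun w => symbNum p w ^ t) {(-(p / (1 - p)) : ℂ)}ᶜ :=
  differentiable_symbNum.differentiableOn.zpow (Or.inl fun _ hw => symbNum_ne_zero hp hw)

/-- This makes the orders at `0` and `1` explicit; the remaining factor is holomorphic away from
`-p/q`. -/
theorem symb_zpow_mul (hw : w ≠ 0) (t e k : ℤ) :
    symb p w ^ t * ((w - 1) / w) ^ e * w ^ k =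
      w ^ (k - t - e) * ((w - 1) ^ e * symbNum p w ^ t) := by
  rw [symb_eq_div hw, div_zpow, div_zpow, zpow_sub₀ hw, zpow_sub₀ hw]
  ring

/-- The identity behind all telescoping: a difference in the time variable equals `p` times a shift
of the level. -/
theorem one_sub_symb (w : ℂ) : 1 - symb p w = p * ((w - 1) / w) := by
  unfold symb; ring

theorem norm_symb_le (hp0 : 0 < p) (hp1 : p < 1) {R : ℝ} (hR : 0 < R) (hw : ‖w‖ = R) :
    ‖symb p w‖ ≤ 1 - p + p / R := by
  have h0 : w ≠ 0 := by rw [← norm_pos_iff, hw]; exact hR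
  have : symb p w = ((1 - p : ℝ) : ℂ) + (p : ℂ) / w := by
    unfold symb; push_cast; field_simp; ring
  rw [this]
  refine (norm_add_le _ _).trans (le_of_eq ?_)
  rw [norm_div, Complex.norm_real, Complex.norm_real, hw, Real.norm_of_nonneg (by linarith),
    Real.norm_of_nonneg hp0.le]

end Symbol

end TasepKernel

namespace TasepKernel

open Complex Metric Set

/-! ### The functions `Ψ^n_j`: recursion, triangularity, decay, reality. -/

section Psi

/-- The function `Ψ^{N-k}_j`, obtained from `Ψ^N_j` by descending `k` levels, as an integral over a
circle around `0` and `1`. -/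
noncomputable def psiInt (p : ℝ) (N : ℕ) (x : ℤ) (c : ℂ) (r : ℝ) (k j : ℕ) (t : ℤ) : ℂ :=
  (2 * Real.pi * I)⁻¹ *
    ∮ w in C(c, r), symb p w ^ t * ((w - 1) / w) ^ ((j : ℤ) - k) * w ^ (x + N - 2)

variable {p : ℝ} {c : ℂ} {r : ℝ}

theorem ne_zero_of_mem_sphere {z : ℂ} (h : 0 ∈ ball c r) (hz : z ∈ sphere c r) : z ≠ 0 := by
  simpa using sub_ne_zero_of_mem_sphere h hz

theorem ne_pole_of_mem_sphere {a z : ℂ} (hP : a ∉ closedBall c r) (hz : z ∈ sphere c r) :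
    z ≠ a := by
  rintro rfl
  exact hP (sphere_subset_closedBall hz)

theorem pole_notMem_closedBall_half (hp0 : 0 < p) (hp1 : p < 1) :
    (-(p / (1 - p)) : ℂ) ∉ closedBall (0 : ℂ) (p / 2) := by
  have h1 : 0 < 1 - p := by linarith
  have : (-(p / (1 - p)) : ℂ) = ((-(p / (1 - p)) : ℝ) : ℂ) := by push_cast; ring
  rw [this, mem_closedBall, dist_zero_right, Complex.norm_real, norm_neg,
    Real.norm_of_nonneg (by positivity), not_le, lt_div_iff₀ h1]
  nlinarith

/-- For `k = 0` the power of `w - 1` is non-negative, so `1` is no pole and the circle may be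
replaced by the small one around `0`. -/
theorem psiInt_zero (hp0 : 0 < p) (hp1 : p < 1) (h0 : 0 ∈ ball c r)
    (hP : (-(p / (1 - p)) : ℂ) ∉ closedBall c r) (N : ℕ) (x : ℤ) (j : ℕ) (t : ℤ) :
    psiInt p N x c r 0 j t = Psi p N x j t := by
  have h0' : (0 : ℂ) ∈ ball (0 : ℂ) (p / 2) := by simp [hp0]
  have hf : DifferentiableOn ℂ (fun w => (w - 1) ^ j * symbNum p w ^ t)
      {(-(p / (1 - p)) : ℂ)}ᶜ :=
    DifferentiableOn.mul (by fun_prop) (differentiableOn_symbNum_zpow hp1 t)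
  have h := circleIntegral_zpow_mul_eq isOpen_compl_singleton
    (subset_compl_singleton_iff.2 hP)
    (subset_compl_singleton_iff.2 (pole_notMem_closedBall_half hp0 hp1)) h0 h0'
    (x + N - 2 - t - j) hf
  unfold psiInt Psi Ftilde
  rw [mul_left_comm, ← circleIntegral.integral_const_mul ((-1) ^ j)]
  congr 1
  calc _ = ∮ w in C(c, r), (w - 0) ^ (x + N - 2 - t - j) *
        ((w - 1) ^ j * symbNum p w ^ t) := by
        refine circleIntegral.integral_congr (pos_of_mem_ball h0).le fun z hz => ?_
        have hz0 := ne_zero_of_mem_sphere h0 hz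
        simp only [Nat.cast_zero, sub_zero]
        rw [symb_zpow_mul hz0, zpow_natCast]
    _ = _ := by
        rw [h]
        refine circleIntegral.integral_congr (by positivity) fun z hz => ?_
        have hz0 := ne_zero_of_mem_sphere h0' hz
        have e : (1 - p : ℂ) + p / z = symbNum p z / z := by
          unfold symbNum; field_simp
        have e2 : (1 - z) ^ j = (-1) ^ j * (z - 1) ^ j := by rw [← mul_pow]; congr 1; ring
        have e3 : (-1 : ℂ) ^ j * (-1) ^ j = 1 := by rw [← mul_pow]; simp
        have e4 : z ^ (x + N - 2 - t - j) = z⁻¹ * z ^ (x + N - j - 1) / z ^ t := by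
          rw [← zpow_neg_one, ← zpow_add₀ hz0, ← zpow_sub₀ hz0]
          congr 1
          ring
        simp only [sub_zero, neg_neg, zpow_natCast]
        rw [e, e2, e4, div_zpow]
        linear_combination (-(z⁻¹ * z ^ (x + N - j - 1) / z ^ t *
          ((z - 1) ^ j * symbNum p z ^ t))) * e3

theorem circleIntegrable_symb (hp1 : p < 1) (h0 : 0 ∈ ball c r) (h1 : 1 ∈ ball c r)
    (hP : (-(p / (1 - p)) : ℂ) ∉ closedBall c r) (t e k : ℤ) :
    CircleIntegrable (fun w => symb p w ^ t * ((w - 1) / w) ^ e * w ^ k) c r := by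
  have hs : ContinuousOn (symb p) (sphere c r) := by
    have : ContinuousOn (fun w => symbNum p w / w) (sphere c r) :=
      differentiable_symbNum.continuous.continuousOn.div continuousOn_id
        fun z hz => ne_zero_of_mem_sphere h0 hz
    exact this.congr fun z hz => symb_eq_div (ne_zero_of_mem_sphere h0 hz)
  refine ContinuousOn.circleIntegrable (pos_of_mem_ball h0).le ?_
  refine ((hs.zpow₀ t fun z hz => Or.inl ?_).mul (ContinuousOn.zpow₀ ?_ e fun z hz =>
    Or.inl ?_)).mul (continuousOn_id.zpow₀ k fun z hz => Or.inl (ne_zero_of_mem_sphere h0 hz))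
  · exact symb_ne_zero hp1 (ne_zero_of_mem_sphere h0 hz) (ne_pole_of_mem_sphere hP hz)
  · exact ContinuousOn.div (by fun_prop) continuousOn_id fun z hz => ne_zero_of_mem_sphere h0 hz
  · exact div_ne_zero (sub_ne_zero_of_mem_sphere h1 hz) (ne_zero_of_mem_sphere h0 hz)

theorem psiInt_sub_psiInt (hp1 : p < 1) (h0 : 0 ∈ ball c r) (h1 : 1 ∈ ball c r)
    (hP : (-(p / (1 - p)) : ℂ) ∉ closedBall c r) (N : ℕ) (x : ℤ) (k j : ℕ) (t : ℤ) :
    psiInt p N x c r (k + 1) j t - psiInt p N x c r (k + 1) j (t + 1) =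
      p * psiInt p N x c r k j t := by
  unfold psiInt
  rw [← mul_sub, ← circleIntegral.integral_sub (circleIntegrable_symb hp1 h0 h1 hP _ _ _)
    (circleIntegrable_symb hp1 h0 h1 hP _ _ _), mul_left_comm,
    ← circleIntegral.integral_const_mul (p : ℂ)]
  congr 1
  refine circleIntegral.integral_congr (pos_of_mem_ball h0).le fun z hz => ?_
  have hz0 := ne_zero_of_mem_sphere h0 hz
  have hz1 := sub_ne_zero_of_mem_sphere h1 hz
  have hs := symb_ne_zero hp1 hz0 (ne_pole_of_mem_sphere hP hz)
  have e : ((z - 1) / z) ^ ((j : ℤ) - k) =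
      ((z - 1) / z) ^ ((j : ℤ) - (k + 1 : ℕ)) * ((z - 1) / z) := by
    rw [← zpow_add_one₀ (div_ne_zero hz1 hz0)]
    congr 1
    push_cast
    ring
  rw [e, zpow_add_one₀ hs]
  linear_combination symb p z ^ t * ((z - 1) / z) ^ ((j : ℤ) - (k + 1 : ℕ)) * z ^ (x + N - 2) *
    one_sub_symb (p := p) z

/-- At position `x` the integrand is `(z - 1)^(m - 1) z^l` times a power of `symbNum`, with `m = i +
j + 1 - N` and `l = 2N - 2 - i - j ≥ 0`. There is no pole at `0`, and one at `1` only for `m = 0`,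
where the residue is `1` because `symbNum p 1 = 1`. -/
theorem psiInt_triangular (hp1 : p < 1) (h0 : 0 ∈ ball c r) (h1 : 1 ∈ ball c r)
    (hP : (-(p / (1 - p)) : ℂ) ∉ closedBall c r) {N : ℕ} (x : ℤ) {i j : ℕ} (hi : i < N)
    (hj : j < N) (hij : N ≤ i + j + 1) :
    psiInt p N x c r (N - i) j x = if i + j + 1 = N then 1 else 0 := by
  have hr := (pos_of_mem_ball h0).le
  obtain ⟨m, hm⟩ : ∃ m : ℕ, i + j + 1 = N + m := ⟨i + j + 1 - N, by omega⟩
  obtain ⟨l, hl⟩ : ∃ l : ℕ, i + j + l = 2 * N - 2 := ⟨2 * N - 2 - (i + j), by omega⟩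
  have key : ∀ z ∈ sphere c r,
      symb p z ^ x * ((z - 1) / z) ^ ((j : ℤ) - (N - i : ℕ)) * z ^ (x + N - 2) =
      (z - 1) ^ ((m : ℤ) - 1) * (z ^ l * symbNum p z ^ x) := by
    intro z hz
    rw [symb_zpow_mul (ne_zero_of_mem_sphere h0 hz),
      show (x + N - 2 - x - ((j : ℤ) - (N - i : ℕ))) = (l : ℤ) by omega,
      show ((j : ℤ) - (N - i : ℕ)) = (m : ℤ) - 1 by omega, zpow_natCast]
    ring
  unfold psiInt
  rw [circleIntegral.integral_congr hr key]
  have hf : DifferentiableOn ℂ (fun z => z ^ l * symbNum p z ^ x) (closedBall c r) :=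
    DifferentiableOn.mul (by fun_prop) ((differentiableOn_symbNum_zpow hp1 x).mono
      (subset_compl_singleton_iff.2 hP))
  rcases m with _ | m
  · rw [if_pos (by omega)]
    have := circleIntegral_sub_inv_mul_of_differentiableOn hf h1
    simp only [Nat.cast_zero, zero_sub, zpow_neg_one]
    rw [this]
    have := Complex.two_pi_I_ne_zero
    simp only [symbNum_one, one_zpow, one_pow, mul_one]
    exact inv_mul_cancel₀ this
  · rw [if_neg (by omega), circleIntegral_eq_zero_of_differentiableOn hr, mul_zero]
    simp only [Nat.cast_add, Nat.cast_one, add_sub_cancel_right, zpow_natCast]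
    exact DifferentiableOn.mul (by fun_prop) hf

/-- Only finitely many `t` lie in `[x, 0)`; the constant absorbs them. -/
theorem exists_geometric_bound_of_nonneg {g : ℤ → ℂ} {K ρ : ℝ} (hρ : 0 < ρ)
    (h : ∀ t, 0 ≤ t → ‖g t‖ ≤ K * ρ ^ t) (x : ℤ) :
    ∃ C, 0 ≤ C ∧ ∀ t, x ≤ t → ‖g t‖ ≤ C * ρ ^ (t - x) := by
  set C' : ℝ := |K| + ∑ s ∈ Finset.Ico x 0, ‖g s‖ * ρ ^ (-s) with hC'
  have hterm : ∀ s, 0 ≤ ‖g s‖ * ρ ^ (-s) := fun s => by positivity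
  have hC0 : 0 ≤ C' := add_nonneg (abs_nonneg _) (Finset.sum_nonneg fun s _ => hterm s)
  refine ⟨C' * ρ ^ x, by positivity, fun t ht => ?_⟩
  rw [mul_assoc, ← zpow_add₀ hρ.ne', add_sub_cancel]
  rcases le_or_gt 0 t with h0 | h0
  · refine (h t h0).trans (mul_le_mul_of_nonneg_right ?_ (by positivity))
    exact (le_abs_self K).trans (le_add_of_nonneg_right (Finset.sum_nonneg fun s _ => hterm s))
  · have h1 : ‖g t‖ * ρ ^ (-t) ≤ C' :=
      (Finset.single_le_sum (fun s _ => hterm s) (Finset.mem_Ico.2 ⟨ht, h0⟩)).trans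
        (le_add_of_nonneg_left (abs_nonneg K))
    calc ‖g t‖ = ‖g t‖ * ρ ^ (-t) * ρ ^ t := by
          rw [mul_assoc, ← zpow_add₀ hρ.ne']; simp
      _ ≤ _ := mul_le_mul_of_nonneg_right h1 (by positivity)

/-- For `t ≥ 0` the point `-p/q` is not singular, so the circle `|w| = 2` is allowed. On it `|q +
p/w| ≤ q + p/2 = 1 - p/2`. -/
theorem psiInt_bound (hp0 : 0 < p) (hp1 : p < 1) (h0 : 0 ∈ ball c r) (h1 : 1 ∈ ball c r)
    (N : ℕ) (x : ℤ) (k j : ℕ) :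
    ∃ C, 0 ≤ C ∧ ∀ t, x ≤ t → ‖psiInt p N x c r k j t‖ ≤ C * (1 - p / 2) ^ (t - x) := by
  have hρ : 0 < 1 - p / 2 := by linarith
  have h0' : (0 : ℂ) ∈ ball (0 : ℂ) 2 := by simp
  have h1' : (1 : ℂ) ∈ ball (0 : ℂ) 2 := by simp
  have hbig : ∀ t : ℤ, 0 ≤ t → psiInt p N x c r k j t = psiInt p N x 0 2 k j t := by
    intro t ht
    have hf : DifferentiableOn ℂ (fun w => symbNum p w ^ t) univ :=
      differentiable_symbNum.differentiableOn.zpow (Or.inr ht)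
    have h := circleIntegral_zpow_mul_zpow_mul_eq isOpen_univ (subset_univ _) (subset_univ _)
      zero_ne_one h0 h0' h1 h1' (x + N - 2 - t - ((j : ℤ) - k)) ((j : ℤ) - k) hf
    have key : ∀ {c : ℂ} {r : ℝ}, 0 ∈ ball c r → psiInt p N x c r k j t =
        (2 * Real.pi * I)⁻¹ * ∮ w in C(c, r), (w - 0) ^ (x + N - 2 - t - ((j : ℤ) - k)) *
          ((w - 1) ^ ((j : ℤ) - k) * symbNum p w ^ t) := by
      intro c r h0
      unfold psiInt
      congr 1
      refine circleIntegral.integral_congr (pos_of_mem_ball h0).le fun z hz => ?_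
      simp only [sub_zero]
      exact symb_zpow_mul (ne_zero_of_mem_sphere h0 hz) _ _ _
    rw [key h0, key h0', h]
  have hcont : ContinuousOn (fun w : ℂ => ((w - 1) / w) ^ ((j : ℤ) - k) * w ^ (x + N - 2))
      (sphere 0 2) := by
    refine ContinuousOn.mul (ContinuousOn.zpow₀ ?_ _ fun z hz => Or.inl ?_)
      (continuousOn_id.zpow₀ _ fun z hz => Or.inl (ne_zero_of_mem_sphere h0' hz))
    · exact ContinuousOn.div (by fun_prop) continuousOn_id
        fun z hz => ne_zero_of_mem_sphere h0' hz
    · exact div_ne_zero (sub_ne_zero_of_mem_sphere h1' hz) (ne_zero_of_mem_sphere h0' hz)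
  obtain ⟨K, hK⟩ := (isCompact_sphere (0 : ℂ) 2).exists_bound_of_continuousOn hcont
  have hlarge : ∀ t : ℤ, 0 ≤ t →
      ‖psiInt p N x c r k j t‖ ≤ 2 * K * (1 - p / 2) ^ t := by
    intro t ht
    rw [hbig t ht, psiInt]
    have := circleIntegral.norm_two_pi_i_inv_smul_integral_le_of_norm_le_const
      (f := fun w => symb p w ^ t * ((w - 1) / w) ^ ((j : ℤ) - k) * w ^ (x + N - 2))
      (c := 0) (R := 2) (C := (1 - p / 2) ^ t * K) (by norm_num) ?_
    · rw [smul_eq_mul] at this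
      refine this.trans (le_of_eq (by ring))
    · intro z hz
      rw [mul_assoc, norm_mul]
      refine mul_le_mul ?_ (hK z hz) (norm_nonneg _) (by positivity)
      lift t to ℕ using ht
      rw [zpow_natCast, zpow_natCast, norm_pow]
      refine pow_le_pow_left₀ (norm_nonneg _) ?_ _
      refine (norm_symb_le hp0 hp1 (R := 2) (by norm_num) (by simpa using hz)).trans
        (le_of_eq (by ring))
  exact exists_geometric_bound_of_nonneg hρ hlarge x

theorem exists_psiInt_bound (hp0 : 0 < p) (hp1 : p < 1) (h0 : 0 ∈ ball c r) (h1 : 1 ∈ ball c r)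
    (N : ℕ) (x : ℤ) : ∃ C, 0 ≤ C ∧ ∀ k ≤ N, ∀ j < N, ∀ t, x ≤ t →
      ‖psiInt p N x c r k j t‖ ≤ C * (1 - p / 2) ^ (t - x) := by
  choose C hC0 hC using psiInt_bound (p := p) (c := c) (r := r) hp0 hp1 h0 h1 N x
  refine ⟨∑ k ∈ Finset.range (N + 1), ∑ j ∈ Finset.range N, C k j,
    Finset.sum_nonneg fun k _ => Finset.sum_nonneg fun j _ => hC0 k j,
    fun k hk j hj t ht => (hC k j t ht).trans ?_⟩
  have hρ : 0 < 1 - p / 2 := by linarith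
  refine mul_le_mul_of_nonneg_right ?_ (by positivity)
  refine (Finset.single_le_sum (f := fun j => C k j) (fun j _ => hC0 k j)
    (Finset.mem_range.2 hj)).trans ?_
  exact Finset.single_le_sum (f := fun k => ∑ j ∈ Finset.range N, C k j)
    (fun k _ => Finset.sum_nonneg fun j _ => hC0 k j) (Finset.mem_range.2 (by omega))

-- Conjugation reverses the orientation of the circle, and this sign cancels the one from `2πi`.
-- Applied to `Psi` it makes the weights real, as a real signed measure requires.
open scoped ComplexConjugate in
theorem conj_two_pi_I_inv_mul_circleIntegral {f : ℂ → ℂ} {R : ℝ}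
    (hf : ∀ z, f (conj z) = conj (f z)) :
    conj ((2 * Real.pi * I)⁻¹ * ∮ w in C(0, R), f w) =
      (2 * Real.pi * I)⁻¹ * ∮ w in C(0, R), f w := by
  have hconj : ∀ θ : ℝ, conj (circleMap 0 R θ) = circleMap 0 R (2 * Real.pi - θ) := by
    intro θ
    have : circleMap 0 R (2 * Real.pi - θ) = circleMap 0 R (-θ) := by
      rw [sub_eq_neg_add]; exact periodic_circleMap 0 R (-θ)
    rw [this]
    simp [circleMap, ← Complex.exp_conj]
  have key : conj (∮ w in C(0, R), f w) = -∮ w in C(0, R), f w := by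
    unfold circleIntegral
    have h1 := intervalIntegral.integral_comp_sub_left (a := 0) (b := 2 * Real.pi)
      (fun θ => deriv (circleMap 0 R) θ • f (circleMap 0 R θ)) (2 * Real.pi)
    simp only [sub_self, sub_zero] at h1
    rw [← intervalIntegral.intervalIntegral_conj, ← h1, ← intervalIntegral.integral_neg]
    refine intervalIntegral.integral_congr fun θ _ => ?_
    simp only [deriv_circleMap, smul_eq_mul, map_mul, Complex.conj_I, ← hconj, hf]
    ring
  have h2 : conj (2 * Real.pi * I : ℂ) = -(2 * Real.pi * I) := by
    rw [map_mul, map_mul, Complex.conj_I, Complex.conj_ofReal, map_ofNat]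
    ring
  rw [map_mul, key, map_inv₀, h2, inv_neg, neg_mul_neg]

theorem Psi_im (p : ℝ) (N : ℕ) (x : ℤ) (k : ℕ) (t : ℤ) : (Psi p N x k t).im = 0 := by
  rw [← Complex.conj_eq_iff_im]
  unfold Psi Ftilde
  rw [map_mul, conj_two_pi_I_inv_mul_circleIntegral]
  · simp
  · intro z
    simp

end Psi

end TasepKernel

namespace TasepKernel

open Complex Metric Set

/-! ### The single integral as transition function between levels. -/

section SingleIntegral

variable {p : ℝ} {c c' : ℂ} {r r' : ℝ}

theorem singleIntegrand_eq {z : ℂ} (hz : z ≠ 0) (e d : ℤ) :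
    p / (2 * Real.pi * I * z ^ 2) * ((z - 1) / z) ^ e * symb p z ^ d =
      z ^ (-2 - d - e) * ((z - 1) ^ e * (p / (2 * Real.pi * I) * symbNum p z ^ d)) := by
  have h := symb_zpow_mul (p := p) hz d e (-2)
  have h2 : z ^ (-2 : ℤ) = (z ^ 2)⁻¹ := by rw [zpow_neg]; rfl
  calc _ = p / (2 * Real.pi * I) * (symb p z ^ d * ((z - 1) / z) ^ e * z ^ (-2 : ℤ)) := by
        rw [h2, ← div_div]; ring
    _ = _ := by rw [h]; ring

theorem singleIntegral_eq (h0 : 0 ∈ ball c r) (n₁ n₂ : ℕ) (τ₁ τ₂ : ℤ) :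
    singleIntegral p c r n₁ τ₁ n₂ τ₂ =
      ∮ z in C(c, r), (z - 0) ^ (-2 - (τ₁ - τ₂ - 1) - ((n₁ : ℤ) - n₂)) *
        ((z - 1) ^ ((n₁ : ℤ) - n₂) * (p / (2 * Real.pi * I) * symbNum p z ^ (τ₁ - τ₂ - 1))) := by
  refine circleIntegral.integral_congr (pos_of_mem_ball h0).le fun z hz => ?_
  simp only [sub_zero]
  exact singleIntegrand_eq (ne_zero_of_mem_sphere h0 hz) _ _

/-- The single integral vanishes when the second point is lower. -/
theorem singleIntegral_eq_zero_of_lt (hp0 : 0 < p) (hp1 : p < 1) (h0 : 0 ∈ ball c r)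
    (h1 : 1 ∈ ball c r) {n₁ n₂ : ℕ} (hn : n₁ ≤ n₂) {τ₁ τ₂ : ℤ} (hτ : τ₂ < τ₁) :
    singleIntegral p c r n₁ τ₁ n₂ τ₂ = 0 := by
  obtain ⟨d, hd⟩ : ∃ d : ℕ, τ₁ - τ₂ - 1 = d := ⟨(τ₁ - τ₂ - 1).toNat, by omega⟩
  obtain ⟨k, hk⟩ : ∃ k : ℕ, (n₁ : ℤ) - n₂ = -k := ⟨n₂ - n₁, by omega⟩
  have hf : DifferentiableOn ℂ (fun w => p / (2 * Real.pi * I) * symbNum p w ^ (τ₁ - τ₂ - 1))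
      univ := by
    refine DifferentiableOn.const_mul ?_ _
    exact differentiable_symbNum.differentiableOn.zpow (Or.inr (by omega))
  -- The symbol has a non-negative power here, so `-p/q` is no obstacle and the circle can grow to
  -- any radius `R`; the integrand is `O(R⁻²)`.
  have hbound : ∀ R : ℝ, 2 ≤ R → ‖singleIntegral p c r n₁ τ₁ n₂ τ₂‖ ≤ 2 ^ k * R⁻¹ := by
    intro R hR
    have hR0 : 0 < R := by linarith
    have h0' : (0 : ℂ) ∈ ball (0 : ℂ) R := by simpa using hR0
    have h1' : (1 : ℂ) ∈ ball (0 : ℂ) R := by simp; linarith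
    have e : singleIntegral p c r n₁ τ₁ n₂ τ₂ = singleIntegral p 0 R n₁ τ₁ n₂ τ₂ := by
      rw [singleIntegral_eq h0, singleIntegral_eq h0']
      exact circleIntegral_zpow_mul_zpow_mul_eq isOpen_univ (subset_univ _) (subset_univ _)
        zero_ne_one h0 h0' h1 h1' _ _ hf
    rw [e, singleIntegral]
    refine (circleIntegral.norm_integral_le_of_norm_le_const (C := (2 * Real.pi * R ^ 2)⁻¹ * 2 ^ k)
      hR0.le fun z hz => ?_).trans (le_of_eq ?_)
    · have hzR : ‖z‖ = R := by simpa using hz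
      have hz1 : R / 2 ≤ ‖z - 1‖ := by
        have := norm_sub_norm_le z 1
        rw [norm_one, hzR] at this
        linarith
      have hz1' : 0 < ‖z - 1‖ := by linarith
      rw [hd, hk, zpow_natCast, zpow_neg, zpow_natCast, norm_mul, norm_mul, norm_inv, norm_pow,
        norm_pow, norm_div, norm_div, hzR, ← inv_pow, inv_div]
      have a1 : ‖(p : ℂ)‖ / ‖2 * Real.pi * I * z ^ 2‖ ≤ (2 * Real.pi * R ^ 2)⁻¹ := by
        rw [norm_mul, norm_pow, hzR, Complex.norm_real, Real.norm_of_nonneg hp0.le]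
        have : ‖(2 * Real.pi * I : ℂ)‖ = 2 * Real.pi := by simp [Real.pi_pos.le]
        rw [this, div_eq_mul_inv]
        exact mul_le_of_le_one_left (by positivity) hp1.le
      have a2 : R / ‖z - 1‖ ≤ 2 := by
        rw [div_le_iff₀ hz1']
        linarith
      have a3 : ‖symb p z‖ ≤ 1 := by
        refine (norm_symb_le hp0 hp1 hR0 hzR).trans ?_
        have : p / R ≤ p := div_le_self hp0.le (by linarith)
        linarith
      calc _ ≤ (2 * Real.pi * R ^ 2)⁻¹ * 2 ^ k * 1 := by
            refine mul_le_mul (mul_le_mul a1 ?_ (by positivity) (by positivity)) ?_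
              (by positivity) (by positivity)
            · exact pow_le_pow_left₀ (by positivity) a2 _
            · exact pow_le_one₀ (norm_nonneg _) a3
        _ = _ := mul_one _
    · have := Real.pi_pos
      field_simp
  by_contra hne
  have hpos : 0 < ‖singleIntegral p c r n₁ τ₁ n₂ τ₂‖ := norm_pos_iff.2 hne
  set s := ‖singleIntegral p c r n₁ τ₁ n₂ τ₂‖ with hs
  have h2k : (0 : ℝ) < 2 ^ k := by positivity
  -- With this radius the bound is at most `s / 2`, which contradicts `s > 0`.
  have := hbound (max 2 (2 * 2 ^ k / s)) (le_max_left _ _)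
  have h3 : (max 2 (2 * 2 ^ k / s))⁻¹ ≤ (2 * 2 ^ k / s)⁻¹ :=
    inv_anti₀ (by positivity) (le_max_right _ _)
  have h4 : 2 ^ k * (2 * 2 ^ k / s)⁻¹ = s / 2 := by field_simp
  have h5 := this.trans (mul_le_mul_of_nonneg_left h3 h2k.le)
  linarith

theorem differentiableOn_singleFactor (hp1 : p < 1)
    (hP : (-(p / (1 - p)) : ℂ) ∉ closedBall c r) (m : ℕ) (d : ℤ) :
    DifferentiableOn ℂ (fun z => z ^ m * (p / (2 * Real.pi * I) * symbNum p z ^ d))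
      (closedBall c r) :=
  DifferentiableOn.mul (by fun_prop) (DifferentiableOn.const_mul
    ((differentiableOn_symbNum_zpow hp1 d).mono (subset_compl_singleton_iff.2 hP)) _)

/-- Between consecutive levels the single integral is the transition function. -/
theorem singleIntegral_succ_level (hp0 : 0 < p) (hp1 : p < 1) (h0 : 0 ∈ ball c r)
    (h1 : 1 ∈ ball c r) (hP : (-(p / (1 - p)) : ℂ) ∉ closedBall c r) (n : ℕ) (τ₁ τ₂ : ℤ) :
    singleIntegral p c r n τ₁ (n + 1) τ₂ = phi p τ₁ τ₂ := by
  unfold phi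
  split_ifs with h
  -- The exponent of `z` is `τ₂ - τ₁ ≥ 0`, so the only pole is the simple one at `1`.
  · obtain ⟨m, hm⟩ : ∃ m : ℕ, -2 - (τ₁ - τ₂ - 1) - ((n : ℤ) - (n + 1 : ℕ)) = m :=
      ⟨(τ₂ - τ₁).toNat, by push_cast; omega⟩
    rw [singleIntegral_eq h0, hm, show (n : ℤ) - (n + 1 : ℕ) = -1 by push_cast; ring]
    have := circleIntegral_sub_inv_mul_of_differentiableOn
      (differentiableOn_singleFactor hp1 hP m (τ₁ - τ₂ - 1)) h1
    simp only [sub_zero, zpow_natCast, zpow_neg_one]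
    simp only [mul_left_comm] at this
    rw [this]
    have hpi := Real.pi_ne_zero
    simp
    field_simp
  · rw [singleIntegral_eq_zero_of_lt hp0 hp1 h0 h1 (by omega) (by omega)]
    simp

/-- Again `one_sub_symb`; it makes sums over `τ₁` telescope. -/
theorem singleIntegral_sub (hp1 : p < 1) (h0 : 0 ∈ ball c r)
    (h1 : 1 ∈ ball c r) (hP : (-(p / (1 - p)) : ℂ) ∉ closedBall c r) (n₁ n₂ : ℕ) (τ₁ τ₂ : ℤ) :
    singleIntegral p c r n₁ τ₁ n₂ τ₂ - singleIntegral p c r n₁ (τ₁ + 1) n₂ τ₂ =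
      p * singleIntegral p c r (n₁ + 1) τ₁ n₂ τ₂ := by
  have hint : ∀ e d : ℤ, CircleIntegrable (fun z => p / (2 * Real.pi * I * z ^ 2) *
      ((z - 1) / z) ^ e * symb p z ^ d) c r := by
    intro e d
    have h := (circleIntegrable_symb hp1 h0 h1 hP d e (-2)).const_smul
      (a := (p / (2 * Real.pi * I) : ℂ))
    refine (circleIntegrable_congr fun z hz => ?_).1 h
    have h2 : z ^ (-2 : ℤ) = (z ^ 2)⁻¹ := by rw [zpow_neg]; rfl
    simp only [Pi.smul_apply, smul_eq_mul]
    rw [h2, ← div_div]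
    ring
  unfold singleIntegral
  rw [← circleIntegral.integral_sub (hint _ _) (hint _ _),
    ← circleIntegral.integral_const_mul (p : ℂ)]
  refine circleIntegral.integral_congr (pos_of_mem_ball h0).le fun z hz => ?_
  have hz0 := ne_zero_of_mem_sphere h0 hz
  have hz1 := sub_ne_zero_of_mem_sphere h1 hz
  have hs := symb_ne_zero hp1 hz0 (ne_pole_of_mem_sphere hP hz)
  rw [show ((n₁ + 1 : ℕ) : ℤ) - n₂ = (n₁ - n₂) + 1 by push_cast; ring,
    zpow_add_one₀ (div_ne_zero hz1 hz0), show τ₁ + 1 - τ₂ - 1 = (τ₁ - τ₂ - 1) + 1 by ring,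
    zpow_add_one₀ hs]
  linear_combination p / (2 * Real.pi * I * z ^ 2) * ((z - 1) / z) ^ ((n₁ : ℤ) - n₂) *
    symb p z ^ (τ₁ - τ₂ - 1) * one_sub_symb (p := p) z

/-- For a circle around `1` but not `0`. -/
theorem singleIntegral_small_circle (hp1 : p < 1) (h0 : 0 ∈ ball c r)
    (h1 : 1 ∈ ball c r) (hP : (-(p / (1 - p)) : ℂ) ∉ closedBall c r)
    (h1' : 1 ∈ ball c' r') (h0' : 0 ∉ closedBall c' r')
    (hP' : (-(p / (1 - p)) : ℂ) ∉ closedBall c' r') (n₁ n₂ : ℕ) {τ₁ τ₂ : ℤ} (hτ : τ₁ ≤ τ₂) :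
    singleIntegral p c' r' n₁ τ₁ n₂ τ₂ =
      if n₁ < n₂ then singleIntegral p c r n₁ τ₁ n₂ τ₂ else 0 := by
  have key : ∀ {c : ℂ} {r : ℝ}, (∀ z ∈ sphere c r, z ≠ 0) → 0 ≤ r →
      singleIntegral p c r n₁ τ₁ n₂ τ₂ =
      ∮ z in C(c, r), (z - 1) ^ ((n₁ : ℤ) - n₂) * (z ^ (-2 - (τ₁ - τ₂ - 1) - ((n₁ : ℤ) - n₂)) *
        (p / (2 * Real.pi * I) * symbNum p z ^ (τ₁ - τ₂ - 1))) := by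
    intro c r h0 hr
    refine circleIntegral.integral_congr hr fun z hz => ?_
    rw [singleIntegrand_eq (h0 z hz), mul_left_comm]
  have hr' := (pos_of_mem_ball h1').le
  have hne : ∀ z ∈ sphere c' r', z ≠ 0 := fun z hz => ne_pole_of_mem_sphere h0' hz
  split_ifs with h
  -- For `τ₁ ≤ τ₂` and `n₁ < n₂` there is no pole at `0`, so it does not matter whether the circle
  -- encloses `0`.
  · obtain ⟨m, hm⟩ : ∃ m : ℕ, -2 - (τ₁ - τ₂ - 1) - ((n₁ : ℤ) - n₂) = m :=
      ⟨(-2 - (τ₁ - τ₂ - 1) - ((n₁ : ℤ) - n₂)).toNat, by omega⟩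
    rw [key hne hr', key (fun z hz => ne_zero_of_mem_sphere h0 hz) (pos_of_mem_ball h0).le, hm]
    simp only [zpow_natCast]
    refine circleIntegral_zpow_mul_eq isOpen_compl_singleton
      (subset_compl_singleton_iff.2 hP') (subset_compl_singleton_iff.2 hP) h1' h1 _ ?_
    exact DifferentiableOn.mul (by fun_prop) (DifferentiableOn.const_mul
      (differentiableOn_symbNum_zpow hp1 _) _)
  -- For `n₁ ≥ n₂` the point `1` is no pole either, and the integrand is holomorphic inside the
  -- small circle.
  · obtain ⟨m, hm⟩ : ∃ m : ℕ, (n₁ : ℤ) - n₂ = m := ⟨n₁ - n₂, by omega⟩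
    rw [key hne hr', hm]
    refine circleIntegral_eq_zero_of_differentiableOn hr' ?_
    simp only [zpow_natCast]
    refine DifferentiableOn.mul (by fun_prop) (DifferentiableOn.mul ?_
      (DifferentiableOn.const_mul ((differentiableOn_symbNum_zpow hp1 _).mono
        (subset_compl_singleton_iff.2 hP')) _))
    exact differentiableOn_id.zpow (Or.inl fun z hz => by
      rintro rfl; exact h0' hz)

end SingleIntegral

/-! ### The double integral: separation of variables and its value at the bottom. -/

section DoubleIntegral

/-- The function `Φ^n_j`, biorthogonal to the `Ψ^n_j`, as an integral over a circle around `1`. -/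
noncomputable def phiInt (p : ℝ) (N : ℕ) (x : ℤ) (c : ℂ) (r : ℝ) (n j : ℕ) (τ : ℤ) : ℂ :=
  (2 * Real.pi * I)⁻¹ * ∮ v in C(c, r),
    p * symb p v ^ (-τ - 1) * ((v - 1) / v) ^ ((N : ℤ) - 1 - j - n) * v ^ (-x - N - 2)

variable {p : ℝ} {c₀ c₁ : ℂ} {r₀ r₁ : ℝ}

/-- With `a = (w - 1)/w` and `b = (v - 1)/v` one has `a - b = (w - v)/(w v)`; this is the geometric
sum for `a^N - b^N`, divided by `a^N`. -/
theorem inv_sub_eq_sum {w v : ℂ} (hw : w ≠ 0) (hv : v ≠ 0) (hw1 : w - 1 ≠ 0) (hwv : w - v ≠ 0)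
    (N : ℕ) :
    (w - v)⁻¹ = (∑ j ∈ Finset.range N,
        w⁻¹ * v⁻¹ * (((w - 1) / w) ^ ((j : ℤ) - N) * ((v - 1) / v) ^ (N - 1 - j))) +
      ((v - 1) / v) ^ N * ((w - 1) / w) ^ (-(N : ℤ)) * (w - v)⁻¹ := by
  have ha : (w - 1) / w ≠ 0 := div_ne_zero hw1 hw
  set a := (w - 1) / w with hadef
  set b := (v - 1) / v with hbdef
  have hab : a - b = (w - v) * (w⁻¹ * v⁻¹) := by
    rw [hadef, hbdef]; field_simp; ring
  have hg := geom_sum₂_mul a b N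
  have e : ∀ j ∈ Finset.range N, w⁻¹ * v⁻¹ * (a ^ ((j : ℤ) - N) * b ^ (N - 1 - j)) =
      w⁻¹ * v⁻¹ * (a ^ N)⁻¹ * (a ^ j * b ^ (N - 1 - j)) := by
    intro j _
    rw [zpow_sub₀ ha, zpow_natCast, zpow_natCast]
    ring
  have haN : a ^ N ≠ 0 := pow_ne_zero _ ha
  rw [Finset.sum_congr rfl e, ← Finset.mul_sum, zpow_neg, zpow_natCast]
  set S := ∑ j ∈ Finset.range N, a ^ j * b ^ (N - 1 - j)
  rw [hab] at hg
  field_simp at hg ⊢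
  linear_combination -hg

/-- Each term of the geometric expansion separates `v` from `w`. The remainder carries `((v -
1)/v)^(N - n₂)`, which has no pole at `v = 1` as `n₂ ≤ N`, so its integral over the `v`-circle
vanishes. -/
theorem doubleIntegral_eq_sum (hp1 : p < 1) (h1 : 1 ∈ ball c₁ r₁) (h0 : 0 ∉ closedBall c₁ r₁)
    (hP : (-(p / (1 - p)) : ℂ) ∉ closedBall c₁ r₁) (h0' : 0 ∈ ball c₀ r₀)
    (hsub : closedBall c₁ r₁ ⊆ ball c₀ r₀) (hP' : (-(p / (1 - p)) : ℂ) ∉ closedBall c₀ r₀)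
    {N : ℕ} (x : ℤ) {n₁ n₂ : ℕ} (hn₁ : n₁ ≤ N) (hn₂ : n₂ ≤ N) (τ₁ τ₂ : ℤ) :
    doubleIntegral p N x c₁ r₁ c₀ r₀ n₁ τ₁ n₂ τ₂ =
      ∑ j ∈ Finset.range N, psiInt p N x c₀ r₀ (N - n₁) j τ₁ * phiInt p N x c₁ r₁ n₂ j τ₂ := by
  have hr₁ := (pos_of_mem_ball h1).le
  have hr₀ := (pos_of_mem_ball h0').le
  have h1' : 1 ∈ ball c₀ r₀ := hsub (ball_subset_closedBall h1)
  have hH : CircleIntegrable (fun w => symb p w ^ τ₁ * ((w - 1) / w) ^ ((n₁ : ℤ) - N) *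
      w ^ (x + N - 1)) c₀ r₀ := circleIntegrable_symb hp1 h0' h1' hP' _ _ _
  set H : ℂ → ℂ := fun w => symb p w ^ τ₁ * ((w - 1) / w) ^ ((n₁ : ℤ) - N) *
      w ^ (x + N - 1) with hHdef
  set R : ℂ → ℂ := fun v => (2 * Real.pi * I)⁻¹ * ∮ w in C(c₀, r₀), (w - v)⁻¹ * H w with hRdef
  -- A Cauchy integral is holomorphic inside its circle whatever singularities `H` has there;
  -- integrability of `H` on the circle suffices.
  have hR : DifferentiableOn ℂ R (ball c₀ r₀) := by
    have hr : ((r₀.toNNReal : NNReal) : ℝ) = r₀ := Real.coe_toNNReal r₀ hr₀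
    have h := (hasFPowerSeriesOn_cauchy_integral (R := r₀.toNNReal) (by rwa [hr])
      (Real.toNNReal_pos.2 (pos_of_mem_ball h0'))).analyticOnNhd.differentiableOn (f := _)
    have e : eball c₀ ((r₀.toNNReal : NNReal) : ENNReal) = ball c₀ r₀ := by
      rw [Metric.eball_coe, hr]
    rw [e, hr] at h
    exact h
  have inner : ∀ v ∈ sphere c₁ r₁, (∮ w in C(c₀, r₀), (2 * Real.pi * I * w)⁻¹ *
      (symb p w ^ τ₁ * ((w - 1) / w) ^ n₁ * (w / v) ^ (x + N) /
        (symb p v ^ (τ₂ + 1) * ((v - 1) / v) ^ n₂ * (w - v)))) =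
      (∑ j ∈ Finset.range N, symb p v ^ (-τ₂ - 1) * ((v - 1) / v) ^ ((N : ℤ) - 1 - j - n₂) *
        v ^ (-x - N - 1) * psiInt p N x c₀ r₀ (N - n₁) j τ₁) +
      symb p v ^ (-τ₂ - 1) * ((v - 1) / v) ^ (N - n₂) * v ^ (-x - N) * R v := by
    intro v hv
    have hv0 : v ≠ 0 := ne_pole_of_mem_sphere h0 hv
    have hv1 := sub_ne_zero_of_mem_sphere h1 hv
    have hvs : symb p v ≠ 0 := symb_ne_zero hp1 hv0 (ne_pole_of_mem_sphere hP hv)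
    have hb : (v - 1) / v ≠ 0 := div_ne_zero hv1 hv0
    have hvb : v ∈ ball c₀ r₀ := hsub (sphere_subset_closedBall hv)
    have hHi : CircleIntegrable (fun w => (w - v)⁻¹ * H w) c₀ r₀ := by
      have hc : ContinuousOn (fun w => (w - v)⁻¹) (sphere c₀ |r₀|) :=
        ContinuousOn.inv₀ (by fun_prop) fun z hz =>
          sub_ne_zero_of_mem_sphere hvb (by rwa [abs_of_nonneg hr₀] at hz)
      exact hH.continuousOn_mul hc
    have hterm : ∀ j : ℕ, CircleIntegrable (fun w => symb p w ^ τ₁ *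
        ((w - 1) / w) ^ ((j : ℤ) - (N - n₁ : ℕ)) * w ^ (x + N - 2)) c₀ r₀ := fun j =>
      circleIntegrable_symb hp1 h0' h1' hP' _ _ _
    simp only [psiInt, hRdef]
    have e1 : ∀ w ∈ sphere c₀ r₀, (2 * Real.pi * I * w)⁻¹ *
      (symb p w ^ τ₁ * ((w - 1) / w) ^ n₁ * (w / v) ^ (x + N) /
        (symb p v ^ (τ₂ + 1) * ((v - 1) / v) ^ n₂ * (w - v))) =
        (∑ j ∈ Finset.range N, (symb p v ^ (-τ₂ - 1) *
          ((v - 1) / v) ^ ((N : ℤ) - 1 - j - n₂) * v ^ (-x - N - 1) * (2 * Real.pi * I)⁻¹) *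
          (symb p w ^ τ₁ * ((w - 1) / w) ^ ((j : ℤ) - (N - n₁ : ℕ)) * w ^ (x + N - 2))) +
        (symb p v ^ (-τ₂ - 1) * ((v - 1) / v) ^ (N - n₂) * v ^ (-x - N) *
          (2 * Real.pi * I)⁻¹) * ((w - v)⁻¹ * H w) := by
      intro w hw
      have hw0 := ne_zero_of_mem_sphere h0' hw
      have hw1 := sub_ne_zero_of_mem_sphere h1' hw
      have hwv := sub_ne_zero_of_mem_sphere hvb hw
      have ha : (w - 1) / w ≠ 0 := div_ne_zero hw1 hw0
      have lhs : (2 * Real.pi * I * w)⁻¹ *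
          (symb p w ^ τ₁ * ((w - 1) / w) ^ n₁ * (w / v) ^ (x + N) /
          (symb p v ^ (τ₂ + 1) * ((v - 1) / v) ^ n₂ * (w - v))) =
          (2 * Real.pi * I)⁻¹ * symb p w ^ τ₁ * ((w - 1) / w) ^ n₁ * w ^ (x + N - 1) *
          v ^ (-x - N) * symb p v ^ (-τ₂ - 1) * (((v - 1) / v) ^ n₂)⁻¹ * (w - v)⁻¹ := by
        rw [div_zpow, zpow_sub_one₀ hw0, show -x - (N : ℤ) = -(x + N) by ring,
          show -τ₂ - 1 = -(τ₂ + 1) by ring, zpow_neg, zpow_neg]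
        simp only [div_eq_mul_inv, mul_inv]
        ring
      rw [lhs]
      conv_lhs => rw [inv_sub_eq_sum hw0 hv0 hw1 hwv N, mul_add, Finset.mul_sum]
      congr 1
      · refine Finset.sum_congr rfl fun j hj => ?_
        have hj' := Finset.mem_range.1 hj
        have b1 : ((v - 1) / v) ^ ((N : ℤ) - 1 - j - n₂) =
            ((v - 1) / v) ^ (N - 1 - j) * (((v - 1) / v) ^ n₂)⁻¹ := by
          rw [zpow_sub₀ hb, zpow_natCast, ← div_eq_mul_inv, ← zpow_natCast _ (N - 1 - j)]
          congr 2
          omega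
        have b2 : ((w - 1) / w) ^ ((j : ℤ) - (N - n₁ : ℕ)) =
            ((w - 1) / w) ^ n₁ * ((w - 1) / w) ^ ((j : ℤ) - N) := by
          rw [← zpow_natCast, ← zpow_add₀ ha]
          congr 1
          omega
        rw [b1, b2, zpow_sub_one₀ hv0, show x + (N : ℤ) - 2 = (x + N - 1) - 1 by ring,
          zpow_sub_one₀ hw0 (x + N - 1)]
        ring
      · have b1 : ((v - 1) / v) ^ (N - n₂) = ((v - 1) / v) ^ N * (((v - 1) / v) ^ n₂)⁻¹ :=
          pow_sub₀ _ hb hn₂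
        have b2 : ((w - 1) / w) ^ ((n₁ : ℤ) - N) =
            ((w - 1) / w) ^ n₁ * ((w - 1) / w) ^ (-(N : ℤ)) := by
          rw [← zpow_natCast, ← zpow_add₀ ha]
          rfl
        simp only [hHdef]
        rw [b1, b2]
        ring
    rw [circleIntegral.integral_congr hr₀ e1, circleIntegral.integral_add,
      circleIntegral.integral_fun_sum, circleIntegral.integral_const_mul]
    · simp only [circleIntegral.integral_const_mul, mul_assoc]
    · exact fun j _ => (hterm j).const_smul
    · exact CircleIntegrable.fun_sum _ fun j _ => (hterm j).const_smul
    · exact hHi.const_smul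
  have hrem : ∮ v in C(c₁, r₁), (2 * Real.pi * I * v)⁻¹ * (symb p v ^ (-τ₂ - 1) *
      ((v - 1) / v) ^ (N - n₂) * v ^ (-x - N) * R v) = 0 := by
    refine circleIntegral_eq_zero_of_differentiableOn hr₁ ?_
    have hne : ∀ v ∈ closedBall c₁ r₁, v ≠ 0 := by
      rintro v hv rfl; exact h0 hv
    have hid : DifferentiableOn ℂ (fun v : ℂ => v) (closedBall c₁ r₁) := differentiableOn_id
    have hsymb : DifferentiableOn ℂ (symb p) (closedBall c₁ r₁) := by
      unfold symb
      exact (((hid.sub_const 1).div hid hne).const_mul _).const_sub _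
    refine DifferentiableOn.mul ((hid.const_mul _).inv fun v hv =>
      mul_ne_zero Complex.two_pi_I_ne_zero (hne v hv)) ?_
    refine ((DifferentiableOn.mul (hsymb.zpow (Or.inl fun v hv => ?_))
      (((hid.sub_const 1).div hid hne).pow _)).mul (hid.zpow (Or.inl hne))).mul (hR.mono hsub)
    exact symb_ne_zero hp1 (hne v hv) fun h => hP (h ▸ hv)
  have hci : ∀ t e k : ℤ, CircleIntegrable (fun w => symb p w ^ t * ((w - 1) / w) ^ e * w ^ k)
      c₁ r₁ := by
    intro t e k
    have hne : ∀ v ∈ sphere c₁ r₁, v ≠ 0 := fun v hv => ne_pole_of_mem_sphere h0 hv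
    have hid : ContinuousOn (fun v : ℂ => v) (sphere c₁ r₁) := continuousOn_id
    have hsymb : ContinuousOn (symb p) (sphere c₁ r₁) := by
      unfold symb
      exact continuousOn_const.sub (continuousOn_const.mul
        ((hid.sub continuousOn_const).div hid hne))
    refine ContinuousOn.circleIntegrable hr₁ (((hsymb.zpow₀ _ fun v hv => Or.inl ?_).mul
      (((hid.sub continuousOn_const).div hid hne).zpow₀ _ fun v hv => Or.inl ?_)).mul
      (hid.zpow₀ _ fun v hv => Or.inl (hne v hv)))
    · exact symb_ne_zero hp1 (hne v hv) (ne_pole_of_mem_sphere hP hv)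
    · exact div_ne_zero (sub_ne_zero_of_mem_sphere h1 hv) (hne v hv)
  unfold doubleIntegral
  have outer : ∀ v ∈ sphere c₁ r₁, (2 * Real.pi * I * v)⁻¹ *
      (∮ w in C(c₀, r₀), (2 * Real.pi * I * w)⁻¹ *
      (symb p w ^ τ₁ * ((w - 1) / w) ^ n₁ * (w / v) ^ (x + N) /
        (symb p v ^ (τ₂ + 1) * ((v - 1) / v) ^ n₂ * (w - v)))) =
      (∑ j ∈ Finset.range N, (psiInt p N x c₀ r₀ (N - n₁) j τ₁ * (2 * Real.pi * I)⁻¹) *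
        (symb p v ^ (-τ₂ - 1) * ((v - 1) / v) ^ ((N : ℤ) - 1 - j - n₂) * v ^ (-x - N - 2))) +
      (2 * Real.pi * I * v)⁻¹ * (symb p v ^ (-τ₂ - 1) *
        ((v - 1) / v) ^ (N - n₂) * v ^ (-x - N) * R v) := by
    intro v hv
    have hv0 : v ≠ 0 := ne_pole_of_mem_sphere h0 hv
    rw [inner v hv, mul_add, Finset.mul_sum]
    congr 1
    refine Finset.sum_congr rfl fun j _ => ?_
    rw [show -x - (N : ℤ) - 2 = (-x - N - 1) - 1 by ring, zpow_sub_one₀ hv0 (-x - N - 1),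
      mul_inv]
    ring
  rw [circleIntegral.integral_congr hr₁ outer, circleIntegral.integral_add, hrem, add_zero,
    circleIntegral.integral_fun_sum, Finset.mul_sum]
  · refine Finset.sum_congr rfl fun j _ => ?_
    rw [circleIntegral.integral_const_mul, phiInt]
    simp only [mul_assoc (p : ℂ)]
    rw [circleIntegral.integral_const_mul]
    ring
  · exact fun j _ => (hci _ _ _).const_smul
  · exact CircleIntegrable.fun_sum _ fun j _ => (hci _ _ _).const_smul
  · refine ContinuousOn.circleIntegrable hr₁ ?_
    have hne : ∀ v ∈ sphere c₁ r₁, v ≠ 0 := fun v hv => ne_pole_of_mem_sphere h0 hv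
    have hid : ContinuousOn (fun v : ℂ => v) (sphere c₁ r₁) := continuousOn_id
    have hsymb : ContinuousOn (symb p) (sphere c₁ r₁) := by
      unfold symb
      exact continuousOn_const.sub (continuousOn_const.mul
        ((hid.sub continuousOn_const).div hid hne))
    refine ContinuousOn.mul ((continuousOn_const.mul hid).inv₀ fun v hv =>
      mul_ne_zero Complex.two_pi_I_ne_zero (hne v hv)) ?_
    refine (((hsymb.zpow₀ _ fun v hv => Or.inl ?_).mul
      (((hid.sub continuousOn_const).div hid hne).pow _)).mul
      (hid.zpow₀ _ fun v hv => Or.inl (hne v hv))).mul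
      (hR.continuousOn.mono (sphere_subset_closedBall.trans hsub))
    exact symb_ne_zero hp1 (hne v hv) (ne_pole_of_mem_sphere hP hv)

/-- At level `i < N` and position `x` the double integral reduces to its residue at `w = v`. -/
theorem doubleIntegral_bottom (hp1 : p < 1) (h1 : 1 ∈ ball c₁ r₁) (h0 : 0 ∉ closedBall c₁ r₁)
    (hP : (-(p / (1 - p)) : ℂ) ∉ closedBall c₁ r₁) (h0' : 0 ∈ ball c₀ r₀)
    (hsub : closedBall c₁ r₁ ⊆ ball c₀ r₀) (hP' : (-(p / (1 - p)) : ℂ) ∉ closedBall c₀ r₀)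
    {N : ℕ} (x : ℤ) {i : ℕ} (hi : i < N) (n₂ : ℕ) (τ₂ : ℤ) :
    doubleIntegral p N x c₁ r₁ c₀ r₀ i x n₂ τ₂ = singleIntegral p c₁ r₁ i x n₂ τ₂ := by
  unfold doubleIntegral singleIntegral
  rw [← circleIntegral.integral_const_mul (p : ℂ)]
  refine circleIntegral.integral_congr (pos_of_mem_ball h1).le fun v hv => ?_
  have hv0 : v ≠ 0 := ne_pole_of_mem_sphere h0 hv
  have hv1 := sub_ne_zero_of_mem_sphere h1 hv
  have hvs : symb p v ≠ 0 := symb_ne_zero hp1 hv0 (ne_pole_of_mem_sphere hP hv)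
  have hb : (v - 1) / v ≠ 0 := div_ne_zero hv1 hv0
  have hvb : v ∈ ball c₀ r₀ := hsub (sphere_subset_closedBall hv)
  -- At position `x` and level `i < N` the integrand keeps the power `w^(m + 1)`. One factor cancels
  -- the `1/w` of the integral, and `w = v` remains as the only pole inside.
  obtain ⟨m, hm⟩ : ∃ m : ℕ, N = i + 1 + m := ⟨N - (i + 1), by omega⟩
  set κ : ℂ := (2 * Real.pi * I)⁻¹ * (v ^ (x + N) * (symb p v ^ (τ₂ + 1) *
    ((v - 1) / v) ^ n₂))⁻¹ with hκ
  have hF : DifferentiableOn ℂ (fun w => κ * (symbNum p w ^ x * (w - 1) ^ i * w ^ m))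
      (closedBall c₀ r₀) := by
    refine DifferentiableOn.const_mul (DifferentiableOn.mul (DifferentiableOn.mul
      ((differentiableOn_symbNum_zpow hp1 x).mono (subset_compl_singleton_iff.2 hP'))
      (by fun_prop)) (by fun_prop)) _
  have key : ∀ {w : ℂ}, w ≠ 0 → symb p w ^ x * ((w - 1) / w) ^ i * w ^ (x + N) =
      symbNum p w ^ x * (w - 1) ^ i * w ^ m * w := by
    intro w hw
    have h := symb_zpow_mul (p := p) hw x i (x + N)
    rw [zpow_natCast, zpow_natCast, show x + (N : ℤ) - x - i = ((m + 1 : ℕ) : ℤ) by omega,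
      zpow_natCast, pow_succ] at h
    rw [h]
    ring
  have inner : (∮ w in C(c₀, r₀), (2 * Real.pi * I * w)⁻¹ *
      (symb p w ^ x * ((w - 1) / w) ^ i * (w / v) ^ (x + N) /
        (symb p v ^ (τ₂ + 1) * ((v - 1) / v) ^ n₂ * (w - v)))) =
      2 * Real.pi * I * (κ * (symbNum p v ^ x * (v - 1) ^ i * v ^ m)) := by
    rw [← circleIntegral_sub_inv_mul_of_differentiableOn hF hvb]
    refine circleIntegral.integral_congr (pos_of_mem_ball h0').le fun w hw => ?_
    have hw0 := ne_zero_of_mem_sphere h0' hw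
    have e : (2 * Real.pi * I * w)⁻¹ * (symb p w ^ x * ((w - 1) / w) ^ i * (w / v) ^ (x + N) /
        (symb p v ^ (τ₂ + 1) * ((v - 1) / v) ^ n₂ * (w - v))) =
        w⁻¹ * (symb p w ^ x * ((w - 1) / w) ^ i * w ^ (x + N)) * κ * (w - v)⁻¹ := by
      rw [hκ, div_zpow, div_eq_mul_inv, div_eq_mul_inv _ (v ^ _), mul_inv, mul_inv, mul_inv,
        mul_inv, mul_inv]
      ring
    rw [e, key hw0]
    field_simp
  rw [inner]
  have h2 := key hv0
  have h3 : symbNum p v ^ x * (v - 1) ^ i * v ^ m =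
      symb p v ^ x * ((v - 1) / v) ^ i * v ^ (x + N) * v⁻¹ := by
    rw [h2]; field_simp
  have hvx : v ^ (x + (N : ℤ)) ≠ 0 := zpow_ne_zero _ hv0
  have hpi := Complex.two_pi_I_ne_zero
  rw [h3, hκ, zpow_sub₀ hb, zpow_natCast, zpow_natCast,
    show x - τ₂ - 1 = x - (τ₂ + 1) by ring, zpow_sub₀ hvs]
  generalize symb p v ^ (τ₂ + 1) = s1
  generalize symb p v ^ x = s2
  generalize (2 * Real.pi * I : ℂ) = π2 at hpi
  generalize v ^ (x + (N : ℤ)) = s3 at hvx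
  rw [mul_inv, mul_inv, mul_inv]
  field_simp

end DoubleIntegral

end TasepKernel

namespace TasepKernel

open Complex Metric Set Filter Topology

/-! ### Duhamel expansion of the point weights. -/

section Duhamel

variable {p : ℝ} {c : ℂ} {r : ℝ}

/-- The transition function between the levels `n₁` and `n₂`, which vanishes unless `n₁ < n₂`. -/
noncomputable def transition (p : ℝ) (c : ℂ) (r : ℝ) (n₁ : ℕ) (τ₁ : ℤ) (b : ℕ × ℤ) : ℂ :=
  if n₁ < b.1 then singleIntegral p c r n₁ τ₁ b.1 b.2 else 0

/-- The weight `1 + g` at the points `a b`, and `1` elsewhere. -/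
noncomputable def pointWeight {m : ℕ} (g : ℂ) (a : Fin m → ℕ × ℤ) (n : ℕ) (y : ℤ) : ℂ :=
  1 + g * ∑ b, if a b = (n, y) then 1 else 0

theorem stepSum_add (p : ℝ) (L : ℤ) (f g : ℤ → ℂ) (z : ℤ) :
    stepSum p L (fun y => f y + g y) z = stepSum p L f z + stepSum p L g z := by
  simp [stepSum, Finset.sum_add_distrib, mul_add]

theorem stepSum_const_mul (p : ℝ) (L : ℤ) (a : ℂ) (f : ℤ → ℂ) (z : ℤ) :
    stepSum p L (fun y => a * f y) z = a * stepSum p L f z := by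
  simp only [stepSum, ← Finset.mul_sum]
  ring

theorem stepSum_mul_const (p : ℝ) (L : ℤ) (a : ℂ) (f : ℤ → ℂ) (z : ℤ) :
    stepSum p L (fun y => f y * a) z = stepSum p L f z * a := by
  simp only [stepSum, ← Finset.sum_mul]
  ring

theorem stepSum_sum {ι : Type*} (s : Finset ι) (p : ℝ) (L : ℤ) (f : ι → ℤ → ℂ) (z : ℤ) :
    stepSum p L (fun y => ∑ i ∈ s, f i y) z = ∑ i ∈ s, stepSum p L (f i) z := by
  simp only [stepSum, ← Finset.mul_sum]
  rw [Finset.sum_comm]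

theorem stepSum_congr {p : ℝ} {L : ℤ} {f g : ℤ → ℂ} {z : ℤ} (h : ∀ y, z ≤ y → y < L → f y = g y) :
    stepSum p L f z = stepSum p L g z := by
  unfold stepSum
  rw [Finset.sum_congr rfl fun y hy => h y (Finset.mem_Ico.1 hy).1 (Finset.mem_Ico.1 hy).2]

/-- The sum telescopes and its boundary term at `L > τ` vanishes. Transition functions therefore
compose exactly, without truncation error. -/
theorem stepSum_singleIntegral (hp0 : 0 < p) (hp1 : p < 1) (h0 : 0 ∈ ball c r)
    (h1 : 1 ∈ ball c r) (hP : (-(p / (1 - p)) : ℂ) ∉ closedBall c r) {n n₂ : ℕ} (hn : n ≤ n₂)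
    {z τ L : ℤ} (hz : z ≤ L) (hτ : τ < L) :
    stepSum p L (fun y => singleIntegral p c r (n + 1) y n₂ τ) z =
      singleIntegral p c r n z n₂ τ := by
  unfold stepSum
  rw [Finset.mul_sum, Finset.sum_congr rfl fun y _ =>
    (singleIntegral_sub hp1 h0 h1 hP n n₂ y τ).symm,
    sum_Ico_telescope (fun y => singleIntegral p c r n y n₂ τ) hz,
    singleIntegral_eq_zero_of_lt hp0 hp1 h0 h1 hn hτ, sub_zero]

theorem stepSum_ite_eq {p : ℝ} {z τ L : ℤ} (hτ : τ < L) (f : ℤ → ℂ) :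
    stepSum p L (fun y => (if τ = y then 1 else 0) * f y) z = phi p z τ * f τ := by
  unfold stepSum phi
  simp only [ite_mul, one_mul, zero_mul]
  rw [Finset.sum_ite_eq]
  simp only [Finset.mem_Ico]
  by_cases h : z ≤ τ <;> simp [h, hτ]

/-- The effect of the point weights on the descending functions. -/
theorem descend_pointWeight (hp0 : 0 < p) (hp1 : p < 1) (h0 : 0 ∈ ball c r)
    (h1 : 1 ∈ ball c r) (hP : (-(p / (1 - p)) : ℂ) ∉ closedBall c r) {N m : ℕ} (g : ℂ)
    {a : Fin m → ℕ × ℤ} (ha : ∀ b, (a b).1 ≤ N) {L : ℤ} (haL : ∀ b, (a b).2 < L) (f : ℤ → ℂ) :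
    ∀ k ≤ N, ∀ z ≤ L, descend p (pointWeight g a) L N k f z =
      descend p (fun _ _ => 1) L N k f z + g * ∑ b, transition p c r (N - k) z (a b) *
        descend p (pointWeight g a) L N (N - (a b).1) f (a b).2 := by
  intro k
  induction k with
  | zero =>
    intro _ z _
    have : ∀ b, transition p c r (N - 0) z (a b) = 0 := fun b =>
      if_neg (by have := ha b; omega)
    simp only [this]
    simp [descend]
  | succ k ih =>
    intro hk z hz
    set H : Fin m → ℂ := fun b => descend p (pointWeight g a) L N (N - (a b).1) f (a b).2 with hH
    set h : ℤ → ℂ := descend p (pointWeight g a) L N k f with hh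
    -- The `1` in the point weight is expanded by the induction hypothesis, while the indicator part
    -- keeps the fully weighted function `h`. The expansion is therefore implicit in the values `H
    -- b`.
    have e1 : descend p (pointWeight g a) L N (k + 1) f z =
        stepSum p L (fun y => descend p (fun _ _ => 1) L N k f y +
          g * ∑ b, (transition p c r (N - k) y (a b) * H b +
            (if a b = (N - k, y) then 1 else 0) * h y)) z := by
      refine stepSum_congr fun y _ hy => ?_
      have := ih (by omega) y hy.le
      rw [Finset.sum_add_distrib, mul_add, ← add_assoc, ← this, pointWeight, ← Finset.sum_mul]
      ring
    have e2 : ∀ b, stepSum p L (fun y => transition p c r (N - k) y (a b) * H b +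
            (if a b = (N - k, y) then 1 else 0) * h y) z =
          transition p c r (N - (k + 1)) z (a b) * H b := by
      intro b
      rw [stepSum_add, stepSum_mul_const]
      have hl : N - k = N - (k + 1) + 1 := by omega
      -- A point above the current level has its transition function extended down by one level. A
      -- point on the level contributes `phi`, the transition across one level. A point below
      -- contributes nothing yet.
      rcases lt_trichotomy (N - k) (a b).1 with hlt | heq | hgt
      · have z2 : stepSum p L (fun y => (if a b = (N - k, y) then 1 else 0) * h y) z = 0 := by
          rw [stepSum_congr (g := fun _ => 0)]
          · simp [stepSum]
          · intro y _ _
            rw [if_neg, zero_mul]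
            intro h'
            rw [h'] at hlt
            exact lt_irrefl _ hlt
        rw [z2, add_zero]
        congr 1
        have : stepSum p L (fun y => transition p c r (N - k) y (a b)) z =
            stepSum p L (fun y => singleIntegral p c r (N - (k + 1) + 1) y (a b).1 (a b).2) z := by
          refine stepSum_congr fun y _ _ => ?_
          rw [← hl]
          exact if_pos hlt
        rw [this, stepSum_singleIntegral hp0 hp1 h0 h1 hP (by omega) hz (haL b), transition,
          if_pos (by omega)]
      · have z1 : stepSum p L (fun y => transition p c r (N - k) y (a b)) z = 0 := by
          rw [stepSum_congr (g := fun _ => 0)]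
          · simp [stepSum]
          · intro y _ _
            exact if_neg (by omega)
        have z2 : stepSum p L (fun y => (if a b = (N - k, y) then 1 else 0) * h y) z =
            stepSum p L (fun y => (if (a b).2 = y then 1 else 0) * h y) z := by
          refine stepSum_congr fun y _ _ => ?_
          congr 1
          refine if_congr ?_ rfl rfl
          rw [Prod.ext_iff]
          simp [heq]
        rw [z1, z2, stepSum_ite_eq (haL b), zero_mul, zero_add]
        have hk' : N - (a b).1 = k := by omega
        have hHb : H b = h (a b).2 := by simp only [hH, hh, hk']
        rw [hHb, transition, if_pos (by omega), show (a b).1 = N - (k + 1) + 1 by omega,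
          singleIntegral_succ_level hp0 hp1 h0 h1 hP]
      · have z1 : stepSum p L (fun y => transition p c r (N - k) y (a b)) z = 0 := by
          rw [stepSum_congr (g := fun _ => 0)]
          · simp [stepSum]
          · intro y _ _
            exact if_neg (by omega)
        have z2 : stepSum p L (fun y => (if a b = (N - k, y) then 1 else 0) * h y) z = 0 := by
          rw [stepSum_congr (g := fun _ => 0)]
          · simp [stepSum]
          · intro y _ _
            rw [if_neg, zero_mul]
            intro h'
            rw [h'] at hgt
            exact lt_irrefl _ hgt
        rw [z1, z2, transition, if_neg (by omega)]
        simp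
    rw [e1, stepSum_add, stepSum_const_mul, stepSum_sum, Finset.sum_congr rfl fun b _ => e2 b]
    congr 1
    refine stepSum_congr fun y _ _ => ?_
    simp

end Duhamel

/-! ### Removing the truncation. -/

section Limits

variable {p : ℝ} {c : ℂ} {r : ℝ}

/-- Each descent adds a boundary term of size at most `C (1 - p/2)^l` and sums the previous error
over at most `l` points. The error is thus polynomial in `l` times a decaying exponential. -/
theorem psiInt_sub_descend_bound (hp0 : 0 < p) (hp1 : p < 1) (h0 : 0 ∈ ball c r)
    (h1 : 1 ∈ ball c r) (hP : (-(p / (1 - p)) : ℂ) ∉ closedBall c r) {N : ℕ} {x : ℤ} {C : ℝ}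
    (hC0 : 0 ≤ C) (hC : ∀ k ≤ N, ∀ j < N, ∀ t, x ≤ t →
      ‖psiInt p N x c r k j t‖ ≤ C * (1 - p / 2) ^ (t - x)) {j : ℕ} (hj : j < N) (l : ℕ) :
    ∀ k ≤ N, ∀ z, x ≤ z → z ≤ x + l →
      ‖psiInt p N x c r k j z - descend p (fun _ _ => 1) (x + l) N k (Psi p N x j) z‖ ≤
        k * (l + 1) ^ k * (C * (1 - p / 2) ^ l) := by
  have hρ : 0 < 1 - p / 2 := by linarith
  set E : ℝ := C * (1 - p / 2) ^ l with hE
  have hE0 : 0 ≤ E := by positivity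
  intro k
  induction k with
  | zero =>
    intro _ z _ _
    rw [psiInt_zero hp0 hp1 h0 hP]
    simp [descend]
  | succ k ih =>
    intro hk z hxz hz
    have htel : psiInt p N x c r (k + 1) j z =
        psiInt p N x c r (k + 1) j (x + l) + stepSum p (x + l) (psiInt p N x c r k j) z := by
      unfold stepSum
      rw [Finset.mul_sum, Finset.sum_congr rfl fun y _ =>
        (psiInt_sub_psiInt hp1 h0 h1 hP N x k j y).symm,
        sum_Ico_telescope (fun y => psiInt p N x c r (k + 1) j y) hz]
      ring
    have hdiff : psiInt p N x c r (k + 1) j z -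
        descend p (fun _ _ => 1) (x + l) N (k + 1) (Psi p N x j) z =
        psiInt p N x c r (k + 1) j (x + l) + p * ∑ y ∈ Finset.Ico z (x + l),
          (psiInt p N x c r k j y - descend p (fun _ _ => 1) (x + l) N k (Psi p N x j) y) := by
      rw [htel, Finset.sum_sub_distrib, mul_sub]
      simp only [descend, stepSum, one_mul]
      ring
    have hlast : ‖psiInt p N x c r (k + 1) j (x + l)‖ ≤ E := by
      refine (hC (k + 1) hk j hj (x + l) (by omega)).trans (le_of_eq ?_)
      rw [hE, add_sub_cancel_left, zpow_natCast]
    have hsum : ‖∑ y ∈ Finset.Ico z (x + l), (psiInt p N x c r k j y -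
        descend p (fun _ _ => 1) (x + l) N k (Psi p N x j) y)‖ ≤
        l * (k * (l + 1) ^ k * E) := by
      refine (norm_sum_le _ _).trans ?_
      refine (Finset.sum_le_card_nsmul _ _ (k * (l + 1) ^ k * E) fun y hy => ?_).trans ?_
      · rw [Finset.mem_Ico] at hy
        exact ih (by omega) y (by omega) (by omega)
      · rw [nsmul_eq_mul, Int.card_Ico]
        refine mul_le_mul_of_nonneg_right ?_ (by positivity)
        exact_mod_cast (by omega : (x + l - z).toNat ≤ l)
    rw [hdiff]
    refine (norm_add_le _ _).trans ?_
    rw [norm_mul, Complex.norm_real, Real.norm_of_nonneg hp0.le]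
    have hA : (1 : ℝ) ≤ (l + 1) ^ k := one_le_pow₀ (by simp)
    have h2 : p * ‖∑ y ∈ Finset.Ico z (x + l), (psiInt p N x c r k j y -
        descend p (fun _ _ => 1) (x + l) N k (Psi p N x j) y)‖ ≤ l * (k * (l + 1) ^ k * E) :=
      (mul_le_of_le_one_left (norm_nonneg _) hp1.le).trans hsum
    have hl : (0 : ℝ) ≤ l := Nat.cast_nonneg l
    have hk0 : (0 : ℝ) ≤ k := Nat.cast_nonneg k
    have h3 : E ≤ (l + 1) ^ (k + 1) * E :=
      le_mul_of_one_le_left hE0 (one_le_pow₀ (by simp))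
    have h4 : l * (k * (l + 1) ^ k * E) ≤ k * (l + 1) ^ (k + 1) * E := by
      rw [pow_succ]
      have : 0 ≤ k * (l + 1 : ℝ) ^ k * E := by positivity
      nlinarith
    push_cast
    linarith

theorem tendsto_descend (hp0 : 0 < p) (hp1 : p < 1) (h0 : 0 ∈ ball c r)
    (h1 : 1 ∈ ball c r) (hP : (-(p / (1 - p)) : ℂ) ∉ closedBall c r) {N : ℕ} {x : ℤ} {j : ℕ}
    (hj : j < N) {k : ℕ} (hk : k ≤ N) {z : ℤ} (hz : x ≤ z) :
    Tendsto (fun l : ℕ => descend p (fun _ _ => 1) (x + l) N k (Psi p N x j) z) atTop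
      (𝓝 (psiInt p N x c r k j z)) := by
  obtain ⟨C, hC0, hC⟩ := exists_psiInt_bound (p := p) hp0 hp1 h0 h1 N x
  have hρ : 0 < 1 - p / 2 := by linarith
  have hlim : Tendsto (fun l : ℕ => k * ((l : ℝ) + 1) ^ k * (C * (1 - p / 2) ^ l)) atTop
      (𝓝 0) := by
    have h := tendsto_pow_const_mul_const_pow_of_abs_lt_one k
      (r := 1 - p / 2) (by rw [abs_of_pos hρ]; linarith)
    have h2 := ((tendsto_add_atTop_iff_nat 1).2 h).const_mul (k * C * (1 - p / 2)⁻¹)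
    rw [mul_zero] at h2
    refine h2.congr fun l => ?_
    push_cast
    generalize 1 - p / 2 = ρ at hρ ⊢
    rw [pow_succ ρ]
    field_simp
  rw [tendsto_iff_norm_sub_tendsto_zero]
  refine squeeze_zero' (Eventually.of_forall fun _ => norm_nonneg _) ?_ hlim
  filter_upwards [eventually_ge_atTop (z - x).toNat] with l hl
  rw [norm_sub_rev]
  exact psiInt_sub_descend_bound hp0 hp1 h0 h1 hP hC0 hC hj l k hk z hz (by omega)

end Limits

/-! ### Determinant identities. -/

section Determinants

open Matrix

/-- Ordered by level, the matrix is block triangular with identity diagonal blocks. -/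
theorem det_one_sub_smul_of_strict {m : ℕ} (level : Fin m → ℕ) (Φ : Matrix (Fin m) (Fin m) ℂ)
    (hΦ : ∀ i j, level j ≤ level i → Φ i j = 0) (g : ℂ) : (1 - g • Φ).det = 1 := by
  have ht : (1 - g • Φ).BlockTriangular level := by
    intro i j hij
    have hne : i ≠ j := by rintro rfl; exact lt_irrefl _ hij
    simp [hΦ i j hij.le, hne]
  rw [ht.det]
  refine Finset.prod_eq_one fun k _ => ?_
  have : (1 - g • Φ).toSquareBlock level k = 1 := by
    ext i j
    have := hΦ i.1 j.1 (by rw [i.2, j.2])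
    simp [Matrix.toSquareBlock, Matrix.toSquareBlockProp, this, Matrix.one_apply,
      Subtype.ext_iff]
  rw [this, det_one]

/-- Factor out `M`, pass from size `N` to size `m` by `det (1 + X Y) = det (1 + Y X)`, and multiply
by `det (1 - gΦ) = 1` to clear the inverse. Invertibility of `M` plays no role. -/
theorem det_add_smul_mul {N m : ℕ} (M : Matrix (Fin N) (Fin N) ℂ) (P : Matrix (Fin N) (Fin m) ℂ)
    (B : Matrix (Fin m) (Fin N) ℂ) (Φ : Matrix (Fin m) (Fin m) ℂ) (g : ℂ)
    (hΦ : (1 - g • Φ).det = 1) :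
    (M + g • (M * P * ((1 - g • Φ)⁻¹ * B))).det = M.det * (1 + g • (B * P - Φ)).det := by
  have e1 : M + g • (M * P * ((1 - g • Φ)⁻¹ * B)) =
      M * (1 + P * (g • ((1 - g • Φ)⁻¹ * B))) := by
    rw [Matrix.mul_add, Matrix.mul_one, Matrix.mul_smul, Matrix.mul_smul, Matrix.mul_assoc]
  rw [e1, det_mul, det_one_add_mul_comm]
  congr 1
  rw [← one_mul (det _), ← hΦ, ← det_mul, Matrix.mul_add, Matrix.mul_one, Matrix.smul_mul,
    Matrix.mul_smul, Matrix.mul_assoc, ← Matrix.mul_assoc (1 - g • Φ),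
    Matrix.mul_nonsing_inv _ (by rw [hΦ]; exact isUnit_one), Matrix.one_mul, smul_sub]
  congr 1
  abel

/-- Reversing the columns yields an upper triangular matrix with unit diagonal. -/
theorem det_psiInt_ne_zero {p : ℝ} {c : ℂ} {r : ℝ} (hp1 : p < 1) (h0 : 0 ∈ ball c r)
    (h1 : 1 ∈ ball c r) (hP : (-(p / (1 - p)) : ℂ) ∉ closedBall c r) (N : ℕ) (x : ℤ) :
    (Matrix.of fun i j : Fin N => psiInt p N x c r (N - i) j x).det ≠ 0 := by
  set M := Matrix.of fun i j : Fin N => psiInt p N x c r (N - i) j x with hM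
  have hM' : ∀ i j : Fin N, N ≤ (i : ℕ) + j + 1 → M i j = if (i : ℕ) + j + 1 = N then 1 else 0 :=
    fun i j hij => psiInt_triangular hp1 h0 h1 hP x i.2 j.2 hij
  have ht : (M.submatrix id Fin.revPerm).IsUpperTriangular := by
    intro i j hij
    simp only [Matrix.submatrix_apply, id, Fin.revPerm_apply]
    have hij' : (j : ℕ) < i := hij
    rw [hM' _ _ (by rw [Fin.val_rev]; omega), if_neg (by rw [Fin.val_rev]; omega)]
  have hd := det_of_isUpperTriangular ht
  have h1' : ∀ i, M.submatrix id Fin.revPerm i i = 1 := by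
    intro i
    simp only [Matrix.submatrix_apply, id, Fin.revPerm_apply]
    rw [hM' _ _ (by rw [Fin.val_rev]; omega), if_pos (by rw [Fin.val_rev]; omega)]
  rw [Finset.prod_congr rfl fun i _ => h1' i, Finset.prod_const_one, det_permute'] at hd
  intro h
  rw [h, mul_zero] at hd
  exact zero_ne_one hd

end Determinants

end TasepKernel

namespace TasepKernel

open Complex Metric Set Filter Topology

/-! ### Absolute convergence, and the point weights as products. -/

section Sums

variable {N : ℕ} {x : ℤ}

theorem tendsto_truncated (N : ℕ) (x : ℤ) :
    Tendsto (fun l : ℕ => truncated x (x + l) N) atTop atTop := by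
  refine tendsto_atTop_finset_of_monotone ?_ ?_
  · intro l l' hl T hT
    rw [mem_truncated] at hT ⊢
    intro n i h1 h2 h3
    have := hT n i h1 h2 h3
    have : (l : ℤ) ≤ l' := by exact_mod_cast hl
    omega
  · intro T
    refine ⟨(∑ n ∈ Finset.range (N + 1), ∑ i ∈ Finset.range (N + 1), (T n i - x).natAbs) + 1,
      mem_truncated.2 fun n i h1 h2 h3 => ?_⟩
    have e1 : (T n i - x).natAbs ≤ ∑ i ∈ Finset.range (N + 1), (T n i - x).natAbs :=
      Finset.single_le_sum (f := fun i => (T n i - x).natAbs) (fun _ _ => Nat.zero_le _)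
        (Finset.mem_range.2 (by omega))
    have e2 : ∑ i ∈ Finset.range (N + 1), (T n i - x).natAbs ≤
        ∑ n ∈ Finset.range (N + 1), ∑ i ∈ Finset.range (N + 1), (T n i - x).natAbs :=
      Finset.single_le_sum (f := fun n => ∑ i ∈ Finset.range (N + 1), (T n i - x).natAbs)
        (fun _ _ => Nat.zero_le _) (Finset.mem_range.2 (by omega))
    omega

/-- `PsiMatrix` is transposed and lists the top level in increasing order; undoing this costs a sign
that is the same for all configurations. -/
theorem weight_eq (p : ℝ) (T : Config N x) :
    weight p T = ((Equiv.Perm.sign (Fin.revPerm (n := N)) : ℤ) : ℂ) *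
      ((∏ n ∈ Finset.range N, (((phiMatrix p T n).det : ℝ) : ℂ)) *
        (Matrix.of fun i j : Fin N => Psi p N x j (T N (i + 1))).det) := by
  have h : PsiMatrix p T = (Matrix.of fun i j : Fin N => Psi p N x j (T N (i + 1))).transpose.submatrix
      id Fin.revPerm := by
    ext i j
    simp only [PsiMatrix, Matrix.of_apply, Matrix.submatrix_apply, Matrix.transpose_apply, id,
      Fin.revPerm_apply, Fin.val_rev]
    rw [show N - ((j : ℕ) + 1) + 1 = N - j by omega]
  rw [weight, h, Matrix.det_permute', Matrix.det_transpose, Complex.ofReal_prod]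
  ring

theorem weight_im (p : ℝ) (T : Config N x) : (weight p T).im = 0 := by
  have h : ∃ A : Matrix (Fin N) (Fin N) ℝ, PsiMatrix p T = A.map Complex.ofRealHom := by
    refine ⟨Matrix.of fun i j => (PsiMatrix p T i j).re, ?_⟩
    ext i j
    exact Complex.ext rfl (Psi_im p N x _ _)
  obtain ⟨A, hA⟩ := h
  have : (PsiMatrix p T).det = ((A.det : ℝ) : ℂ) := by
    rw [hA, ← Complex.ofRealHom_eq_coe, RingHom.map_det]
    rfl
  rw [weight, this, ← Complex.ofReal_mul, Complex.ofReal_im]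

/-- There is a circle around `0` and `1` that leaves `-p/q` outside. -/
theorem exists_circle {p : ℝ} (hp0 : 0 < p) (hp1 : p < 1) : ∃ (c : ℂ) (r : ℝ),
    0 ∈ ball c r ∧ 1 ∈ ball c r ∧ (-(p / (1 - p)) : ℂ) ∉ closedBall c r := by
  have hq : 0 < 1 - p := by linarith
  refine ⟨((1 / 2 : ℝ) : ℂ), (1 + p) / 2, ?_, ?_, ?_⟩
  · rw [mem_ball, dist_eq_norm, zero_sub, norm_neg, Complex.norm_real]
    norm_num
    linarith
  · rw [mem_ball, dist_eq_norm, ← Complex.ofReal_one, ← Complex.ofReal_sub, Complex.norm_real]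
    norm_num
    linarith
  · have : (-(p / (1 - p)) : ℂ) = ((-(p / (1 - p)) : ℝ) : ℂ) := by push_cast; ring
    rw [mem_closedBall, dist_eq_norm, this, ← Complex.ofReal_sub, Complex.norm_real,
      Real.norm_eq_abs, not_le, lt_abs]
    right
    have : p ≤ p / (1 - p) := le_div_self hp0.le hq (by linarith)
    linarith

/-- Pulling `(1 - p/2)^(τ - x)` out of each row leaves a determinant with bounded entries, at most
`N! C^N`; the rest is `exists_sum_truncated_abs_le`. -/
theorem summable_weight {p : ℝ} (hp0 : 0 < p) (hp1 : p < 1) (N : ℕ) (x : ℤ) :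
    Summable fun T : Config N x => ‖weight p T‖ := by
  have hρ : 0 < 1 - p / 2 := by linarith
  obtain ⟨C, hC0, hC⟩ : ∃ C : ℝ, 0 ≤ C ∧ ∀ j < N, ∀ t, x ≤ t →
      ‖Psi p N x j t‖ ≤ C * (1 - p / 2) ^ (t - x) := by
    obtain ⟨c, r, h0, h1, hP⟩ := exists_circle hp0 hp1
    obtain ⟨C, hC0, hC⟩ := exists_psiInt_bound (p := p) hp0 hp1 h0 h1 N x
    refine ⟨C, hC0, fun j hj t ht => ?_⟩
    rw [← psiInt_zero hp0 hp1 h0 hP]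
    exact hC 0 (Nat.zero_le _) j hj t ht
  obtain ⟨C', hC'⟩ := exists_sum_truncated_abs_le hp0.le hρ (by linarith) N x
  have hle : ∀ T : Config N x, ‖weight p T‖ ≤ (N.factorial * C ^ N) *
      (|∏ n ∈ Finset.range N, (phiMatrix p T n).det| *
        ∏ i : Fin N, (1 - p / 2) ^ (T N (i + 1) - x)) := by
    intro T
    have hdet : (Matrix.of fun i j : Fin N => Psi p N x j (T N (i + 1))).det =
        (∏ i : Fin N, (((1 - p / 2) ^ (T N (i + 1) - x) : ℝ) : ℂ)) *
        (Matrix.of fun i j : Fin N => (((1 - p / 2) ^ (T N (i + 1) - x) : ℝ) : ℂ)⁻¹ *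
          Psi p N x j (T N (i + 1))).det := by
      rw [← Matrix.det_mul_column]
      congr 1
      ext i j
      have : (((1 - p / 2) ^ (T N (i + 1) - x) : ℝ) : ℂ) ≠ 0 := by
        rw [Complex.ofReal_ne_zero]; positivity
      simp only [Matrix.of_apply]
      rw [mul_inv_cancel_left₀ this]
    have hb : ‖(Matrix.of fun i j : Fin N => (((1 - p / 2) ^ (T N (i + 1) - x) : ℝ) : ℂ)⁻¹ *
          Psi p N x j (T N (i + 1))).det‖ ≤ N.factorial * C ^ N := by
      have := Matrix.det_le (A := Matrix.of fun i j : Fin N =>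
        (((1 - p / 2) ^ (T N (i + 1) - x) : ℝ) : ℂ)⁻¹ * Psi p N x j (T N (i + 1)))
        (abv := NormedField.toAbsoluteValue ℂ) (x := C) fun i j => ?_
      · rw [nsmul_eq_mul, Fintype.card_fin] at this
        exact this
      · have hpos : 0 < (1 - p / 2) ^ (T N (i + 1) - x) := by positivity
        show ‖(((1 - p / 2) ^ (T N (i + 1) - x) : ℝ) : ℂ)⁻¹ * Psi p N x j (T N (i + 1))‖ ≤ C
        rw [norm_mul, norm_inv, Complex.norm_real, Real.norm_of_nonneg hpos.le,
          inv_mul_le_iff₀ hpos, mul_comm]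
        exact hC j j.2 _ (T.lower _ _ (by omega) (by omega) le_rfl)
    have hsign : ‖((Equiv.Perm.sign (Fin.revPerm (n := N)) : ℤ) : ℂ)‖ = 1 := by
      rcases Int.units_eq_one_or (Equiv.Perm.sign (Fin.revPerm (n := N))) with h | h <;> simp [h]
    rw [weight_eq, norm_mul, hsign, one_mul, norm_mul, ← Complex.ofReal_prod, Complex.norm_real,
      Real.norm_eq_abs, hdet, norm_mul, ← Complex.ofReal_prod, Complex.norm_real,
      Real.norm_of_nonneg (Finset.prod_nonneg fun i _ => by positivity)]
    calc _ ≤ |∏ n ∈ Finset.range N, (phiMatrix p T n).det| *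
          ((∏ i : Fin N, (1 - p / 2) ^ (T N (i + 1) - x)) * (N.factorial * C ^ N)) := by
          refine mul_le_mul_of_nonneg_left (mul_le_mul_of_nonneg_left hb ?_) (abs_nonneg _)
          exact Finset.prod_nonneg fun i _ => by positivity
      _ = _ := by ring
  refine summable_of_sum_le (c := (N.factorial * C ^ N) * C') (fun T => norm_nonneg _) fun u => ?_
  obtain ⟨l, hl⟩ := ((tendsto_truncated N x).eventually_ge_atTop u).exists
  calc ∑ T ∈ u, ‖weight p T‖ ≤ ∑ T ∈ truncated x (x + l) N, ‖weight p T‖ :=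
        Finset.sum_le_sum_of_subset_of_nonneg hl fun _ _ _ => norm_nonneg _
    _ ≤ ∑ T ∈ truncated x (x + l) N, (N.factorial * C ^ N) *
      (|∏ n ∈ Finset.range N, (phiMatrix p T n).det| *
        ∏ i : Fin N, (1 - p / 2) ^ (T N (i + 1) - x)) := Finset.sum_le_sum fun T _ => hle T
    _ ≤ _ := by
        rw [← Finset.mul_sum]
        exact mul_le_mul_of_nonneg_left (hC' _) (by positivity)

-- As the points are distinct, at most one indicator in `pointWeight` is non-zero; as each level is
-- strictly decreasing, each point is met at most once.
open scoped Classical in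
theorem prod_pointWeight {m : ℕ} (g : ℂ) {a : Fin m → ℕ × ℤ} (ha : Function.Injective a)
    (ha1 : ∀ b, 1 ≤ (a b).1) (T : Config N x) :
    ∏ n ∈ Finset.range N, ∏ i : Fin (n + 1), pointWeight g a (n + 1) (T (n + 1) (i + 1)) =
      ∏ b, if a b ∈ T.points then 1 + g else 1 := by
  have hpw : ∀ n y, pointWeight g a n y = ∏ b, if a b = (n, y) then 1 + g else 1 := by
    intro n y
    unfold pointWeight
    by_cases h : ∃ b, a b = (n, y)
    · obtain ⟨b₀, hb₀⟩ := h
      have hne : ∀ b, b ≠ b₀ → ¬ a b = (n, y) := fun b hb h => hb (ha (h.trans hb₀.symm))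
      rw [Finset.sum_eq_single b₀ (fun b _ hb => if_neg (hne b hb)) (by simp),
        Finset.prod_eq_single b₀ (fun b _ hb => if_neg (hne b hb)) (by simp), if_pos hb₀,
        if_pos hb₀, mul_one]
    · push Not at h
      simp [h]
  simp only [hpw]
  rw [Finset.prod_congr rfl fun n _ => Finset.prod_comm, Finset.prod_comm]
  refine Finset.prod_congr rfl fun b _ => ?_
  by_cases h : a b ∈ T.points
  · rw [if_pos h]
    obtain ⟨hN, i, hi1, hi2, hT⟩ := h
    obtain ⟨n, hn⟩ : ∃ n, (a b).1 = n + 1 := ⟨(a b).1 - 1, by have := ha1 b; omega⟩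
    obtain ⟨k, rfl⟩ : ∃ k, i = k + 1 := ⟨i - 1, by omega⟩
    rw [hn] at hN hi2 hT
    have hab : a b = (n + 1, T (n + 1) (k + 1)) := Prod.ext hn hT.symm
    rw [Finset.prod_eq_single n, Finset.prod_eq_single (⟨k, by omega⟩ : Fin (n + 1)),
      if_pos hab]
    · intro j _ hj
      refine if_neg fun h' => hj ?_
      rw [hab] at h'
      exact ((T.strictAnti_level hN).injective (Prod.ext_iff.1 h').2).symm
    · simp
    · intro n' _ hn'
      refine Finset.prod_eq_one fun j _ => if_neg fun h' => hn' ?_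
      have := (Prod.ext_iff.1 h').1
      simp only at this
      omega
    · intro h'
      exact absurd (Finset.mem_range.2 (by omega)) h'
  · rw [if_neg h]
    refine Finset.prod_eq_one fun n hn => Finset.prod_eq_one fun j _ => if_neg fun h' => h ?_
    rw [h']
    have := Finset.mem_range.1 hn
    exact ⟨by simp only; omega, j + 1, by omega, by simp only; omega, rfl⟩

end Sums

end TasepKernel

namespace TasepKernel

open Complex Metric Set Filter Topology

/-! ### The generating function and the correlation functions. -/

section Correlations

variable {p : ℝ} {c₀ c : ℂ} {r₀ r : ℝ} {N : ℕ} {x : ℤ} {m : ℕ}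

/-- The matrix `[Ψ^{N-i}_j(x)]` of the pairings of `Ψ^N_j` with the bottom functions. -/
noncomputable def pairingMatrix (p : ℝ) (N : ℕ) (x : ℤ) (c₀ : ℂ) (r₀ : ℝ) :
    Matrix (Fin N) (Fin N) ℂ :=
  Matrix.of fun i j => psiInt p N x c₀ r₀ (N - i) j x

/-- The matrix of the values at the points `a b` of the functions `Ψ^n_j`. -/
noncomputable def psiMatrixAt (p : ℝ) (N : ℕ) (x : ℤ) (c₀ : ℂ) (r₀ : ℝ) (a : Fin m → ℕ × ℤ) :
    Matrix (Fin m) (Fin N) ℂ :=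
  Matrix.of fun b j => psiInt p N x c₀ r₀ (N - (a b).1) j (a b).2

/-- The matrix of the transition functions between the points `a b`. -/
noncomputable def transitionMatrix (p : ℝ) (c : ℂ) (r : ℝ) (a : Fin m → ℕ × ℤ) :
    Matrix (Fin m) (Fin m) ℂ :=
  Matrix.of fun b b' => transition p c r (a b).1 (a b).2 (a b')

-- For large truncations the sum is exactly a perturbed determinant, and continuity of `det` carries
-- the identity to the limit. Any `Q` solving `hQ` will do, so the pairing matrix is never inverted.
open scoped Classical in
theorem tsum_weight_mul_prod (hp0 : 0 < p) (hp1 : p < 1)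
    (h0 : 0 ∈ ball c r) (h1 : 1 ∈ ball c r) (hP : (-(p / (1 - p)) : ℂ) ∉ closedBall c r)
    (h0' : 0 ∈ ball c₀ r₀) (h1' : 1 ∈ ball c₀ r₀)
    (hP' : (-(p / (1 - p)) : ℂ) ∉ closedBall c₀ r₀) {a : Fin m → ℕ × ℤ}
    (ha : Function.Injective a) (ha' : ∀ b, 1 ≤ (a b).1 ∧ (a b).1 ≤ N ∧ x ≤ (a b).2)
    (Q : Matrix (Fin N) (Fin m) ℂ)
    (hQ : pairingMatrix p N x c₀ r₀ * Q =
      Matrix.of fun (i : Fin N) b => transition p c r i x (a b)) (g : ℂ) :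
    ∑' T : Config N x, weight p T * ∏ b, (if a b ∈ T.points then 1 + g else 1) =
      ((Equiv.Perm.sign (Fin.revPerm (n := N)) : ℤ) : ℂ) * (pairingMatrix p N x c₀ r₀).det *
        (1 + g • (psiMatrixAt p N x c₀ r₀ a * Q - transitionMatrix p c r a)).det := by
  set Φ := transitionMatrix p c r a with hΦdef
  have hΦ : (1 - g • Φ).det = 1 :=
    det_one_sub_smul_of_strict (fun b => (a b).1) Φ (fun i j hij => if_neg (not_lt.2 hij)) g
  set σ : ℂ := ((Equiv.Perm.sign (Fin.revPerm (n := N)) : ℤ) : ℂ) with hσ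
  have hsum : Summable fun T : Config N x =>
      weight p T * ∏ b, (if a b ∈ T.points then 1 + g else 1) := by
    refine Summable.of_norm_bounded ((summable_weight hp0 hp1 N x).mul_right
      ((max ‖1 + g‖ 1) ^ m)) fun T => ?_
    rw [norm_mul]
    refine mul_le_mul_of_nonneg_left ?_ (norm_nonneg _)
    rw [norm_prod]
    refine (Finset.prod_le_prod (fun _ _ => norm_nonneg _) fun b _ => ?_).trans
      (le_of_eq (by simp : ∏ _b : Fin m, max ‖1 + g‖ 1 = (max ‖1 + g‖ 1) ^ m))
    split_ifs
    · exact le_max_left _ _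
    · simp
  -- truncation at `x + l`
  set M : ℕ → Matrix (Fin N) (Fin N) ℂ := fun l => Matrix.of fun i j =>
    descend p (fun _ _ => 1) (x + l) N (N - i) (Psi p N x j) x with hM
  set B : ℕ → Matrix (Fin m) (Fin N) ℂ := fun l => Matrix.of fun b j =>
    descend p (fun _ _ => 1) (x + l) N (N - (a b).1) (Psi p N x j) (a b).2 with hB
  have htrunc : ∀ᶠ l : ℕ in atTop, ∑ T ∈ truncated x (x + l) N,
      weight p T * ∏ b, (if a b ∈ T.points then 1 + g else 1) =
      σ * (M l + g • (pairingMatrix p N x c₀ r₀ * Q * ((1 - g • Φ)⁻¹ * B l))).det := by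
    have hev : ∀ᶠ l : ℕ in atTop, ∀ b, (a b).2 < x + l := by
      rw [eventually_all]
      intro b
      filter_upwards [eventually_gt_atTop ((a b).2 - x).toNat] with l hl
      omega
    filter_upwards [hev] with l hl
    set H : Matrix (Fin m) (Fin N) ℂ := Matrix.of fun b j =>
      descend p (pointWeight g a) (x + l) N (N - (a b).1) (Psi p N x j) (a b).2 with hH
    have hdesc := fun (j : Fin N) => descend_pointWeight hp0 hp1 h0 h1 hP (N := N) g (a := a)
      (fun b => (ha' b).2.1) hl (Psi p N x j)
    -- The Duhamel expansion at the points themselves is a linear system for `H`, solved by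
    -- inverting `1 - g • Φ`.
    have eH : H = B l + g • (Φ * H) := by
      ext b j
      have hb := ha' b
      have h := hdesc j (N - (a b).1) (by omega) (a b).2 (hl b).le
      rw [show N - (N - (a b).1) = (a b).1 by omega] at h
      simp only [hH, hB, hΦdef, transitionMatrix, Matrix.add_apply, Matrix.smul_apply,
        Matrix.mul_apply, Matrix.of_apply, smul_eq_mul]
      exact h
    have eH' : H = (1 - g • Φ)⁻¹ * B l := by
      have : (1 - g • Φ) * H = B l := by
        rw [Matrix.sub_mul, Matrix.one_mul, Matrix.smul_mul]
        nth_rewrite 1 [eH]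
        abel
      rw [← this, ← Matrix.mul_assoc, Matrix.nonsing_inv_mul _ (by rw [hΦ]; exact isUnit_one),
        Matrix.one_mul]
    -- The same expansion started from the bottom positions `(i, x)`.
    have eM : (Matrix.of fun i j : Fin N =>
        descend p (pointWeight g a) (x + l) N (N - i) (Psi p N x j) x) =
        M l + g • (pairingMatrix p N x c₀ r₀ * Q * ((1 - g • Φ)⁻¹ * B l)) := by
      rw [← eH', hQ]
      ext i j
      have h := hdesc j (N - i) (by omega) x (by omega)
      rw [show N - (N - (i : ℕ)) = i by omega] at h
      simp only [hM, hH, Matrix.add_apply, Matrix.smul_apply, Matrix.mul_apply, Matrix.of_apply,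
        smul_eq_mul]
      exact h
    rw [← eM, ← sum_truncated_weight p (pointWeight g a) (x + l) N fun j => Psi p N x j,
      Finset.mul_sum]
    refine Finset.sum_congr rfl fun T _ => ?_
    rw [weight_eq, prod_pointWeight g ha fun b => (ha' b).1]
    ring
  have hlimM : Tendsto M atTop (𝓝 (pairingMatrix p N x c₀ r₀)) := by
    refine tendsto_pi_nhds.2 fun i => tendsto_pi_nhds.2 fun j => ?_
    exact tendsto_descend hp0 hp1 h0' h1' hP' j.2 (by omega) le_rfl
  have hlimB : Tendsto B atTop (𝓝 (psiMatrixAt p N x c₀ r₀ a)) := by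
    refine tendsto_pi_nhds.2 fun b => tendsto_pi_nhds.2 fun j => ?_
    exact tendsto_descend hp0 hp1 h0' h1' hP' j.2 (by omega) (ha' b).2.2
  have hcont : Continuous fun Z : Matrix (Fin N) (Fin N) ℂ × Matrix (Fin m) (Fin N) ℂ =>
      σ * (Z.1 + g • (pairingMatrix p N x c₀ r₀ * Q * ((1 - g • Φ)⁻¹ * Z.2))).det := by
    refine continuous_const.mul (Continuous.matrix_det ?_)
    exact continuous_fst.add ((continuous_const.matrix_mul
      (continuous_const.matrix_mul continuous_snd)).const_smul g)
  have hlim := (hcont.tendsto _).comp (hlimM.prodMk_nhds hlimB)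
  have hlim' := hsum.hasSum.comp (tendsto_truncated N x)
  have := tendsto_nhds_unique (hlim'.congr' htrunc) hlim
  rw [this, det_add_smul_mul _ _ _ _ _ hΦ, mul_assoc]

theorem partitionFunction_eq (hp0 : 0 < p) (hp1 : p < 1)
    (h0 : 0 ∈ ball c₀ r₀) (h1 : 1 ∈ ball c₀ r₀) (hP : (-(p / (1 - p)) : ℂ) ∉ closedBall c₀ r₀)
    (N : ℕ) (x : ℤ) : partitionFunction p N x =
      ((Equiv.Perm.sign (Fin.revPerm (n := N)) : ℤ) : ℂ) * (pairingMatrix p N x c₀ r₀).det := by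
  have h := tsum_weight_mul_prod (N := N) (x := x) (a := Fin.elim0) hp0 hp1 h0 h1 hP h0 h1 hP
    (fun b => b.elim0) (fun b => b.elim0) 0 (by ext i j; exact j.elim0) 0
  simpa [partitionFunction] using h

theorem partitionFunction_ne_zero (hp0 : 0 < p) (hp1 : p < 1) (N : ℕ) (x : ℤ) :
    partitionFunction p N x ≠ 0 := by
  obtain ⟨c, r, h0, h1, hP⟩ := exists_circle hp0 hp1
  rw [partitionFunction_eq hp0 hp1 h0 h1 hP]
  refine mul_ne_zero ?_ (det_psiInt_ne_zero hp1 h0 h1 hP N x)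
  exact_mod_cast (Equiv.Perm.sign (Fin.revPerm (n := N))).ne_zero

theorem partitionFunction_im (p : ℝ) (N : ℕ) (x : ℤ) : (partitionFunction p N x).im = 0 := by
  have h : ∀ T : Config N x, weight p T = (((weight p T).re : ℝ) : ℂ) := fun T =>
    Complex.ext rfl (weight_im p T)
  rw [partitionFunction, tsum_congr h, ← Complex.ofReal_tsum, Complex.ofReal_im]

open scoped Classical in
/-- The weighted sum over the configurations that contain the points `a b`. -/
theorem tsum_weight_ite_mem (hp0 : 0 < p) (hp1 : p < 1)
    (h0 : 0 ∈ ball c r) (h1 : 1 ∈ ball c r) (hP : (-(p / (1 - p)) : ℂ) ∉ closedBall c r)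
    (h0' : 0 ∈ ball c₀ r₀) (h1' : 1 ∈ ball c₀ r₀)
    (hP' : (-(p / (1 - p)) : ℂ) ∉ closedBall c₀ r₀) {a : Fin m → ℕ × ℤ}
    (ha : Function.Injective a) (ha' : ∀ b, 1 ≤ (a b).1 ∧ (a b).1 ≤ N ∧ x ≤ (a b).2)
    (Q : Matrix (Fin N) (Fin m) ℂ)
    (hQ : pairingMatrix p N x c₀ r₀ * Q =
      Matrix.of fun (i : Fin N) b => transition p c r i x (a b)) :
    ∑' T : Config N x, (if ∀ b, a b ∈ T.points then weight p T else 0) =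
      partitionFunction p N x *
        (psiMatrixAt p N x c₀ r₀ a * Q - transitionMatrix p c r a).det := by
  set K := psiMatrixAt p N x c₀ r₀ a * Q - transitionMatrix p c r a with hK
  -- `ε` plays the role of `1/g`. Multiplication by `ε^m` turns the factors `1 + g` and `1` into `ε
  -- + 1` and `ε`, so in the limit only configurations through all the points survive, while `det (ε
  -- + K)` tends to `det K`.
  set ε : ℕ → ℂ := fun n => 1 / ((n : ℂ) + 1) with hε
  have hε0 : Tendsto ε atTop (𝓝 0) := tendsto_one_div_add_atTop_nhds_zero_nat
  have hεne : ∀ n, ε n ≠ 0 := fun n => by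
    have : (n : ℂ) + 1 ≠ 0 := Nat.cast_add_one_ne_zero n
    simp [hε, this]
  have hε1 : ∀ n, ‖ε n‖ ≤ 1 := fun n => by
    have e : ((n : ℂ) + 1) = ((n + 1 : ℕ) : ℂ) := by push_cast; rfl
    rw [hε]
    simp only [norm_div, norm_one, e, Complex.norm_natCast]
    rw [div_le_one (by positivity)]
    simp
  have heq : ∀ n, ∑' T : Config N x, weight p T *
      ∏ b, (ε n + if a b ∈ T.points then 1 else 0) =
      partitionFunction p N x * (ε n • (1 : Matrix (Fin m) (Fin m) ℂ) + K).det := by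
    intro n
    have h := tsum_weight_mul_prod hp0 hp1 h0 h1 hP h0' h1' hP' ha ha' Q hQ (ε n)⁻¹
    rw [← partitionFunction_eq hp0 hp1 h0' h1' hP'] at h
    have e1 : ε n • (1 : Matrix (Fin m) (Fin m) ℂ) + K = ε n • (1 + (ε n)⁻¹ • K) := by
      rw [smul_add, smul_inv_smul₀ (hεne n)]
    rw [e1, Matrix.det_smul, Fintype.card_fin, mul_left_comm, ← h, ← tsum_mul_left]
    refine tsum_congr fun T => ?_
    rw [mul_left_comm]
    congr 1
    have e2 : ε n ^ m = ∏ _b : Fin m, ε n := by simp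
    rw [e2, ← Finset.prod_mul_distrib]
    refine Finset.prod_congr rfl fun b _ => ?_
    have := hεne n
    split_ifs
    · field_simp
    · simp
  have hR : Tendsto (fun n => partitionFunction p N x *
      (ε n • (1 : Matrix (Fin m) (Fin m) ℂ) + K).det) atTop
      (𝓝 (partitionFunction p N x * K.det)) := by
    have hc : Continuous fun e : ℂ => partitionFunction p N x *
        (e • (1 : Matrix (Fin m) (Fin m) ℂ) + K).det :=
      continuous_const.mul (Continuous.matrix_det
        ((continuous_id.smul continuous_const).add continuous_const))
    have := (hc.tendsto 0).comp hε0
    simp only [zero_smul, zero_add] at this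
    exact this
  have hL : Tendsto (fun n => ∑' T : Config N x, weight p T *
      ∏ b, (ε n + if a b ∈ T.points then 1 else 0)) atTop
      (𝓝 (∑' T : Config N x, (if ∀ b, a b ∈ T.points then weight p T else 0))) := by
    refine tendsto_tsum_of_dominated_convergence
      ((summable_weight hp0 hp1 N x).mul_right (2 ^ m)) (fun T => ?_)
      (Eventually.of_forall fun n T => ?_)
    · have hc : Continuous fun e : ℂ => weight p T *
          ∏ b, (e + if a b ∈ T.points then 1 else 0) := by fun_prop
      have h := (hc.tendsto 0).comp hε0
      have e : weight p T * ∏ b, ((0 : ℂ) + if a b ∈ T.points then 1 else 0) =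
          if ∀ b, a b ∈ T.points then weight p T else 0 := by
        split_ifs with hall
        · simp [hall]
        · push Not at hall
          obtain ⟨b, hb⟩ := hall
          rw [Finset.prod_eq_zero (Finset.mem_univ b) (by simp [hb]), mul_zero]
      rw [e] at h
      exact h
    · rw [norm_mul]
      refine mul_le_mul_of_nonneg_left ?_ (norm_nonneg _)
      rw [norm_prod]
      refine (Finset.prod_le_prod (fun _ _ => norm_nonneg _) fun b _ => ?_).trans
        (le_of_eq (by simp : ∏ _b : Fin m, (2 : ℝ) = 2 ^ m))
      refine (norm_add_le _ _).trans ?_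
      have := hε1 n
      split_ifs <;> simp <;> linarith
  exact tendsto_nhds_unique (hL.congr heq) hR

theorem kernel_matrix_eq {c₁ : ℂ} {r₁ : ℝ} (hp1 : p < 1) (h1 : 1 ∈ ball c₁ r₁)
    (h0 : 0 ∉ closedBall c₁ r₁)
    (hP : (-(p / (1 - p)) : ℂ) ∉ closedBall c₁ r₁) (h0' : 0 ∈ ball c₀ r₀)
    (hsub : closedBall c₁ r₁ ⊆ ball c₀ r₀) (hP' : (-(p / (1 - p)) : ℂ) ∉ closedBall c₀ r₀)
    {a : Fin m → ℕ × ℤ} (ha' : ∀ b, 1 ≤ (a b).1 ∧ (a b).1 ≤ N ∧ x ≤ (a b).2) :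
    (Matrix.of fun i j => kernel p N x c₁ r₁ c₀ r₀ c r (a i) (a j)) =
      psiMatrixAt p N x c₀ r₀ a * (Matrix.of fun (j : Fin N) b =>
        phiInt p N x c₁ r₁ (a b).1 j (a b).2) - transitionMatrix p c r a := by
  ext i j
  simp only [Matrix.of_apply, Matrix.sub_apply, Matrix.mul_apply, kernel, psiMatrixAt,
    transitionMatrix, transition]
  rw [doubleIntegral_eq_sum hp1 h1 h0 hP h0' hsub hP' x (ha' i).2.1 (ha' j).2.1,
    Finset.sum_range]

/-- Both sides are the double integral at the bottom point `(i, x)`: on the left in separated form,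
on the right through its residue at `w = v`. -/
theorem pairingMatrix_mul_phiInt {c₁ : ℂ} {r₁ : ℝ} (hp1 : p < 1) (h1 : 1 ∈ ball c₁ r₁)
    (h0 : 0 ∉ closedBall c₁ r₁)
    (hP : (-(p / (1 - p)) : ℂ) ∉ closedBall c₁ r₁) (h0' : 0 ∈ ball c₀ r₀)
    (hsub : closedBall c₁ r₁ ⊆ ball c₀ r₀) (hP' : (-(p / (1 - p)) : ℂ) ∉ closedBall c₀ r₀)
    (hc0 : 0 ∈ ball c r) (hc1 : 1 ∈ ball c r) (hcP : (-(p / (1 - p)) : ℂ) ∉ closedBall c r)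
    {a : Fin m → ℕ × ℤ} (ha' : ∀ b, 1 ≤ (a b).1 ∧ (a b).1 ≤ N ∧ x ≤ (a b).2) :
    pairingMatrix p N x c₀ r₀ * (Matrix.of fun (j : Fin N) b =>
        phiInt p N x c₁ r₁ (a b).1 j (a b).2) =
      Matrix.of fun (i : Fin N) b => transition p c r i x (a b) := by
  ext i b
  simp only [Matrix.of_apply, Matrix.mul_apply, pairingMatrix]
  rw [transition, ← singleIntegral_small_circle hp1 hc0 hc1 hcP h1 h0 hP _ _ (ha' b).2.2,
    ← doubleIntegral_bottom hp1 h1 h0 hP h0' hsub hP' x i.2,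
    doubleIntegral_eq_sum hp1 h1 h0 hP h0' hsub hP' x i.2.le (ha' b).2.1,
    Finset.sum_range]

end Correlations

/-! ### Signed measures from summable point masses. -/

section Measure

/-- The signed measure on a discrete space with given summable point masses. -/
noncomputable def signedMeasureOfSummable {α : Type*} [MeasurableSpace α] {f : α → ℝ}
    (hf : Summable f) : MeasureTheory.SignedMeasure α where
  measureOf' s := ∑' a, open scoped Classical in if MeasurableSet s ∧ a ∈ s then f a else 0
  empty' := by simp
  not_measurable' s hs := by simp [hs]
  m_iUnion' s hs hd := by
    classical
    simp only [hs, MeasurableSet.iUnion hs, true_and]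
    -- By disjointness `(i, a) ↦ a` is injective on the pairs with `a ∈ s i`, so the double family
    -- inherits summability from `f` and can be summed in either order.
    have hsigma : Summable fun q : ℕ × α => if q.2 ∈ s q.1 then f q.2 else 0 := by
      have hi : Function.Injective fun q : {q : ℕ × α // q.2 ∈ s q.1} => q.1.2 := by
        rintro ⟨⟨i, a⟩, hq⟩ ⟨⟨j, b⟩, hq'⟩ h
        simp only at h hq hq'
        subst h
        have : i = j := by
          by_contra hij
          exact Set.disjoint_left.1 (hd hij) hq hq'
        subst this
        rfl
      have h := hf.comp_injective hi
      rw [show (fun q : ℕ × α => if q.2 ∈ s q.1 then f q.2 else 0) =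
        Set.indicator {q : ℕ × α | q.2 ∈ s q.1} (fun q => f q.2) from by
          funext q; simp [Set.indicator]]
      exact summable_subtype_iff_indicator.1 h
    have hcol : ∀ b, HasSum (fun i => if b ∈ s i then f b else 0)
        (if b ∈ ⋃ i, s i then f b else 0) := by
      intro b
      split_ifs with hb
      · obtain ⟨i, hi⟩ := Set.mem_iUnion.1 hb
        have := hasSum_single (f := fun i => if b ∈ s i then f b else 0) i fun j hj =>
          if_neg fun hbj => Set.disjoint_left.1 (hd hj) hbj hi
        simpa [hi] using this
      · have hz : ∀ i, b ∉ s i := fun i hi => hb (Set.mem_iUnion.2 ⟨i, hi⟩)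
        simp [hz]
    have h1 := hsigma.hasSum.prod_fiberwise fun i => (hsigma.prod_factor i).hasSum
    have h2 := ((Equiv.prodComm α ℕ).hasSum_iff.2 hsigma.hasSum).prod_fiberwise hcol
    rw [h2.tsum_eq]
    exact h1

theorem signedMeasureOfSummable_apply {α : Type*} [MeasurableSpace α] {f : α → ℝ}
    (hf : Summable f) {s : Set α} (hs : MeasurableSet s) [DecidablePred (· ∈ s)] :
    signedMeasureOfSummable hf s = ∑' a, if a ∈ s then f a else 0 := by
  refine tsum_congr fun a => ?_
  simp [hs]

end Measure

end TasepKernel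

/-! ### The main theorem. -/

open TasepKernel in
theorem mainTheorem5 (p : ℝ) (hp0 : 0 < p) (hp1 : p < 1) (N : ℕ) (x : ℤ) :
    Summable (fun T : Config N x => weight p T) ∧
    partitionFunction p N x ≠ 0 ∧
    ∃ M : MeasureTheory.SignedMeasure (Config N x),
      (∀ T : Config N x, ((M {T} : ℝ) : ℂ) = (partitionFunction p N x)⁻¹ * weight p T) ∧
      ∀ (c₁ : ℂ) (r₁ : ℝ) (c₀ : ℂ) (r₀ : ℝ) (c : ℂ) (r : ℝ),
        -- the contour of `v` encircles `1` but neither `0` nor `-p/q`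
        1 ∈ Metric.ball c₁ r₁ →
        0 ∉ Metric.closedBall c₁ r₁ →
        (-(p / (1 - p)) : ℂ) ∉ Metric.closedBall c₁ r₁ →
        -- the contour of `w` encircles `0` and the contour of `v`, but not `-p/q`
        0 ∈ Metric.ball c₀ r₀ →
        Metric.closedBall c₁ r₁ ⊆ Metric.ball c₀ r₀ →
        (-(p / (1 - p)) : ℂ) ∉ Metric.closedBall c₀ r₀ →
        -- the contour of `z` encircles `0` and `1`, but not `-p/q`
        0 ∈ Metric.ball c r →
        1 ∈ Metric.ball c r →
        (-(p / (1 - p)) : ℂ) ∉ Metric.closedBall c r →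
        IsCorrelationKernel M (kernel p N x c₁ r₁ c₀ r₀ c r) := by
  classical
  have hW := summable_weight hp0 hp1 N x
  have hZ := partitionFunction_ne_zero hp0 hp1 N x
  set Z := partitionFunction p N x with hZdef
  -- Weights and normalization are real, so nothing is lost by taking real parts for the point
  -- masses.
  have hreal : ∀ T : Config N x, ((Z.re⁻¹ * (weight p T).re : ℝ) : ℂ) = Z⁻¹ * weight p T := by
    intro T
    have e1 : ((Z.re : ℝ) : ℂ) = Z := Complex.ext rfl (partitionFunction_im p N x).symm
    have e2 : (((weight p T).re : ℝ) : ℂ) = weight p T := Complex.ext rfl (weight_im p T).symm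
    rw [Complex.ofReal_mul, Complex.ofReal_inv, e1, e2]
  have hf : Summable fun T : Config N x => Z.re⁻¹ * (weight p T).re :=
    (Complex.hasSum_re hW.of_norm.hasSum).summable.mul_left _
  have happly : ∀ s : Set (Config N x), ((signedMeasureOfSummable hf s : ℝ) : ℂ) =
      Z⁻¹ * ∑' T, if T ∈ s then weight p T else 0 := by
    intro s
    rw [signedMeasureOfSummable_apply hf MeasurableSpace.measurableSet_top, Complex.ofReal_tsum,
      ← tsum_mul_left]
    refine tsum_congr fun T => ?_
    rw [mul_ite, mul_zero, ← hreal]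
    split_ifs <;> simp
  refine ⟨hW.of_norm, hZ, signedMeasureOfSummable hf, fun T => ?_, ?_⟩
  · rw [happly]
    congr 1
    refine (tsum_eq_single T fun T' hT' => ?_).trans (if_pos (Set.mem_singleton T))
    exact if_neg hT'
  · intro c₁ r₁ c₀ r₀ c r h1 h0 hP h0' hsub hP' hc0 hc1 hcP m a ha ha'
    have h := tsum_weight_ite_mem hp0 hp1 hc0 hc1 hcP h0'
      (hsub (Metric.ball_subset_closedBall h1)) hP' ha ha' _
      (pairingMatrix_mul_phiInt hp1 h1 h0 hP h0' hsub hP' hc0 hc1 hcP ha')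
    rw [happly, kernel_matrix_eq hp1 h1 h0 hP h0' hsub hP' ha']
    refine (congrArg (Z⁻¹ * ·) ((tsum_congr fun T => ?_).trans h)).trans
      (inv_mul_cancel_left₀ hZ _)
    by_cases hT : ∀ b, a b ∈ T.points
    · exact (if_pos hT).trans (if_pos hT).symm
    · exact (if_neg hT).trans (if_neg hT).symm
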